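/- Let $q$ be a prime power, let $m,n,r$ be positive integers with $m \mid rn$, and write $[i]=q^i$. For $s\ge 0$ let $\theta_s$ raise every coordinate of a vector in $\mathbb{F}_{q^m}^n$ (respectively every coefficient of a polynomial over $\mathbb{F}_{q^m}$) to the power $q^s$. Let $C\subseteq \mathbb{F}_{q^m}^n$ be an $\mathbb{F}_{q^m}$-linear $q^r$-cyclic code, i.e. $(c_{n-1}^{[r]},c_0^{[r]},\dots,c_{n-2}^{[r]})\in C$ for all $(c_0,\dots,c_{n-1})\in C$. Put $C^{[i]}=\theta_i(C)$, $C^*=\sum_{i=0}^{m-1}C^{[i]}$ and $C^0=\bigcap_{i=0}^{m-1}C^{[i]}$. Consider the ring of $q^r$-linearized polynomials $F(x)=F_0x+F_1x^{[r]}+\cdots+F_dx^{[dr]}$ over $\mathbb{F}_{q^m}$, with composition $\otimes$ as product. Divisibility, (monic) $\gcd$ and (monic) $\mathrm{lcm}$ are taken on the right: $D$ divides $F$ if $F=P\otimes D$ for some linearized $P$. For $F$ with $F_0\ne0$, $F_d\neq 0$ and $d\le n$ put $$F^\perp(x)=\sum_{i=0}^d \frac{F_{d-i}^{[ir]}}{F_0^{[dr]}}\,x^{[ir]},\qquad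 F^\top(x)=\sum_{i=0}^d\Big(\frac{F_{d-i}}{F_0}\Big)^{[(n-d+i)r]}x^{[ir]},$$ $$F^*=\gcd(F,\theta_1(F),\dots,\theta_{m-1}(F)),\qquad F^0=\mathrm{lcm}(F,\theta_1(F),\dots,\theta_{m-1}(F)),$$ $$F_*=\gcd(F^\perp,\theta_1(F)^\perp,\dots,\theta_{m-1}(F)^\perp)^\top,\qquad F_0=\mathrm{lcm}(F^\perp,\theta_1(F)^\perp,\dots,\theta_{m-1}(F)^\perp)^\top$$ (the polynomial $F_0$ is not to be confused with the coefficient $F_0$). The generator polynomial $G$ and check polynomial $H$ of a linear $q^r$-cyclic code $D\subseteq\mathbb{F}_{q^m}^n$ are defined as follows: $G$ is monic and of minimal degree among the nonzero $q^r$-linearized polynomials congruent modulo $x^{[rn]}-x$ to $c_0x+c_1x^{[r]}+\cdots+c_{n-1}x^{[(n-1)r]}$ for some $(c_0,\dots,c_{n-1})\in D$, and $H$ is $q^r$-linearized with $x^{[rn]}-x=G\otimes H=H\otimes G$. The conventional generator and check polynomials $g,h$ of a linear cyclic code $D$ are defined likewise: $g$ is monic and of minimal degree among the nonzero polynomials congruent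 modulo $x^n-1$ to $c_0+c_1x+\cdots+c_{n-1}x^{n-1}$ for some $(c_0,\dots,c_{n-1})\in D$, and $gh=x^n-1$. Let $L(f_0+f_1x+\cdots+f_dx^d)=f_0x+f_1x^{[r]}+\cdots+f_dx^{[dr]}$. Then $C$ has unique generator and check polynomials $G,H$. The codes $C^*$ and $C^0$ are both cyclic and $q^r$-cyclic. As $q^r$-cyclic codes, $C^*$ has generator polynomial $G^*$ and check polynomial $H_0$, and $C^0$ has generator polynomial $G^0$ and check polynomial $H_*$. As cyclic codes, $C^*$ has unique conventional generator and check polynomials, denoted $g^*,h^0$, and $C^0$ has unique conventional generator and check polynomials, denoted $g^0,h^*$; and $$G^*=L(g^*),\qquad H_0=L(h^0),\qquad G^0=L(g^0),\qquad H_*=L(h^*).$$ -/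

import Mathlib

open Polynomial

noncomputable section

namespace SkewCyclic

section Codes

variable (Fq : Type*) {K : Type*} [Field Fq] [Fintype Fq] [Field K] [Finite K] [Algebra Fq K]

/-- The `s`-th Frobenius map `a ↦ a ^ (q ^ s)` of the field `K` with `q ^ m` elements, where `q` is
the number of elements of the subfield `Fq` and `m` is the degree of `K` over `Fq`. -/
def frob (s : ℕ) : K →+* K where
  toFun a := a ^ (Fintype.card Fq ^ s)
  map_one' := one_pow _
  map_mul' a b := mul_pow a b _
  map_zero' := zero_pow (pow_ne_zero _ Fintype.card_ne_zero)
  map_add' a b := by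
    have h : ∀ x : K, x ^ (Fintype.card Fq ^ s) = (FiniteField.frobeniusAlgHom Fq K ^ s) x := by
      intro x
      induction s with
      | zero => simp
      | succ k ih =>
        rw [pow_succ, pow_mul, ih, pow_succ', AlgHom.mul_apply,
          FiniteField.frobeniusAlgHom_apply]
    simp only [h, map_add]

theorem frob_surjective (s : ℕ) : Function.Surjective (frob Fq s : K →+* K) :=
  Finite.surjective_of_injective (frob Fq s : K →+* K).injective

variable {n : ℕ}

/-- `θ_s` on vectors: raise every coordinate to the power `q ^ s`. -/
def frobVec (s : ℕ) (c : Fin n → K) : Fin n → K := fun i => c i ^ (Fintype.card Fq ^ s)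

/-- The shifting operator `(c_0, …, c_{n-1}) ↦ (c_{n-1}, c_0, …, c_{n-2})`
(subtraction in `Fin n` is modulo `n`). -/
def shift {K : Type*} [NeZero n] (c : Fin n → K) : Fin n → K := fun i => c (i - 1)

/-- A linear code is cyclic if it is stable under the shifting operator. -/
def IsCyclicCode [NeZero n] (C : Submodule K (Fin n → K)) : Prop :=
  ∀ c ∈ C, shift c ∈ C

/-- A linear code is `q ^ r`-cyclic if it is stable under the `q ^ r`-shifting operator
`θ_r ∘ shift`. -/
def IsSkewCyclic [NeZero n] (r : ℕ) (C : Submodule K (Fin n → K)) : Prop :=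
  ∀ c ∈ C, frobVec Fq r (shift c) ∈ C

/-- The code `C^{[s]} = θ_s(C)`. -/
def frobCode (s : ℕ) (C : Submodule K (Fin n → K)) : Submodule K (Fin n → K) where
  carrier := frobVec Fq s '' (C : Set (Fin n → K))
  zero_mem' := ⟨0, C.zero_mem, funext fun _ => map_zero (frob Fq s : K →+* K)⟩
  add_mem' := by
    rintro _ _ ⟨a, ha, rfl⟩ ⟨b, hb, rfl⟩
    exact ⟨a + b, C.add_mem ha hb, funext fun i => map_add (frob Fq s) (a i) (b i)⟩
  smul_mem' := by
    rintro t _ ⟨a, ha, rfl⟩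
    obtain ⟨u, rfl⟩ := frob_surjective Fq s t
    exact ⟨u • a, C.smul_mem u ha, funext fun i => map_mul (frob Fq s) u (a i)⟩

/-- The Galois closure `C^* = ∑_{i=0}^{m-1} C^{[i]}`, with `m = [K : Fq]`. -/
def galoisClosure (C : Submodule K (Fin n → K)) : Submodule K (Fin n → K) :=
  ⨆ i : Fin (Module.finrank Fq K), frobCode Fq i C

/-- The Galois interior `C^0 = ⋂_{i=0}^{m-1} C^{[i]}`, with `m = [K : Fq]`. -/
def galoisInterior (C : Submodule K (Fin n → K)) : Submodule K (Fin n → K) :=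
  ⨅ i : Fin (Module.finrank Fq K), frobCode Fq i C

end Codes

section Conventional

variable {K : Type*} [Field K] {n : ℕ}

/-- The residue class of `f` modulo `x ^ n - 1` lies in `C(x)`, that is, it is the class of
`c_0 + c_1 x + ⋯ + c_{n-1} x ^ (n-1)` for some codeword `c`. -/
def InIdeal (C : Submodule K (Fin n → K)) (f : K[X]) : Prop :=
  ∃ c ∈ C, ∃ p : K[X],
    f = ∑ i : Fin n, Polynomial.C (c i) * X ^ (i : ℕ) + p * (X ^ n - 1)

/-- `g` and `h` are the generator and check polynomials of the linear cyclic code `C`: `g` is monic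
and of minimal degree among the nonzero polynomials whose class lies in `C(x)`, and
`g h = x ^ n - 1`. -/
structure IsGenCheck [NeZero n] (C : Submodule K (Fin n → K)) (g h : K[X]) : Prop where
  cyclic : IsCyclicCode C
  monic : g.Monic
  mem : InIdeal C g
  minimal : ∀ f : K[X], InIdeal C f → f ≠ 0 → g.natDegree ≤ f.natDegree
  mul_eq : g * h = X ^ n - 1

end Conventional

section Linearized

variable {K : Type*} [Field K]

/-- `F` is a `Q`-linearized polynomial `F_0 x + F_1 x ^ Q + ⋯ + F_d x ^ (Q ^ d)`. The product of
the ring of linearized polynomials is the composition `Polynomial.comp`. -/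
def IsLinearized (Q : ℕ) (F : K[X]) : Prop :=
  ∀ k : ℕ, F.coeff k ≠ 0 → ∃ i : ℕ, k = Q ^ i

/-- `D` divides `F` on the right in the ring of `Q`-linearized polynomials: `F = P ⊗ D`. -/
def RightDvd (Q : ℕ) (D F : K[X]) : Prop :=
  ∃ P : K[X], IsLinearized Q P ∧ F = P.comp D

/-- `D` is the (monic) greatest common right divisor of the family `S`. -/
structure IsRightGcd (Q : ℕ) {ι : Type*} (S : ι → K[X]) (D : K[X]) : Prop where
  linearized : IsLinearized Q D
  monic : D.Monic
  dvd : ∀ i, RightDvd Q D (S i)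
  greatest : ∀ E : K[X], IsLinearized Q E → (∀ i, RightDvd Q E (S i)) → RightDvd Q E D

/-- `M` is the (monic) least common multiple of the family `S` for divisibility on the right. -/
structure IsRightLcm (Q : ℕ) {ι : Type*} (S : ι → K[X]) (M : K[X]) : Prop where
  linearized : IsLinearized Q M
  monic : M.Monic
  dvd : ∀ i, RightDvd Q (S i) M
  least : ∀ E : K[X], IsLinearized Q E → (∀ i, RightDvd Q (S i) E) → RightDvd Q M E

open Classical in
/-- The monic greatest common right divisor of a family (`0` if there is none). -/
def rightGcd (Q : ℕ) {ι : Type*} (S : ι → K[X]) : K[X] :=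
  if h : ∃ D, IsRightGcd Q S D then h.choose else 0

open Classical in
/-- The monic least common multiple of a family, on the right (`0` if there is none). -/
def rightLcm (Q : ℕ) {ι : Type*} (S : ι → K[X]) : K[X] :=
  if h : ∃ M, IsRightLcm Q S M then h.choose else 0

/-- The `Q`-degree: `d` for a linearized polynomial `F_0 x + ⋯ + F_d x ^ (Q ^ d)`, `F_d ≠ 0`. -/
def linDegree (Q : ℕ) (F : K[X]) : ℕ := Nat.log Q F.natDegree

/-- The coefficient `F_i` of `x ^ (Q ^ i)`. -/
def linCoeff (Q : ℕ) (F : K[X]) (i : ℕ) : K := F.coeff (Q ^ i)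

/-- `F^⊥ = ∑_{i=0}^{d} (F_{d-i} ^ (Q ^ i) / F_0 ^ (Q ^ d)) x ^ (Q ^ i)`. -/
def linPerp (Q : ℕ) (F : K[X]) : K[X] :=
  ∑ i ∈ Finset.range (linDegree Q F + 1),
    Polynomial.C (linCoeff Q F (linDegree Q F - i) ^ (Q ^ i) /
      linCoeff Q F 0 ^ (Q ^ linDegree Q F)) * X ^ (Q ^ i)

/-- `F^⊤ = ∑_{i=0}^{d} (F_{d-i} / F_0) ^ (Q ^ (n-d+i)) x ^ (Q ^ i)`, for `F` dividing
`x ^ (Q ^ n) - x` (so that `d ≤ n`). -/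
def linTop (Q n : ℕ) (F : K[X]) : K[X] :=
  ∑ i ∈ Finset.range (linDegree Q F + 1),
    Polynomial.C ((linCoeff Q F (linDegree Q F - i) / linCoeff Q F 0) ^
      (Q ^ (n - linDegree Q F + i))) * X ^ (Q ^ i)

/-- The map `L(f_0 + f_1 x + ⋯ + f_d x ^ d) = f_0 x + f_1 x ^ Q + ⋯ + f_d x ^ (Q ^ d)`. -/
def linearize (Q : ℕ) (f : K[X]) : K[X] :=
  f.sum fun i a => Polynomial.C a * X ^ (Q ^ i)

end Linearized

section SkewGenerators

variable (Fq : Type*) {K : Type*} [Field Fq] [Fintype Fq] [Field K] [Finite K] [Algebra Fq K]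

/-- `F^* = gcd(F, θ_1(F), …, θ_{m-1}(F))`, in the ring of `q ^ r`-linearized polynomials. -/
def upperStar (r : ℕ) (F : K[X]) : K[X] :=
  rightGcd (Fintype.card Fq ^ r)
    fun i : Fin (Module.finrank Fq K) => F.map (frob Fq i)

/-- `F^0 = lcm(F, θ_1(F), …, θ_{m-1}(F))`, in the ring of `q ^ r`-linearized polynomials. -/
def upperZero (r : ℕ) (F : K[X]) : K[X] :=
  rightLcm (Fintype.card Fq ^ r)
    fun i : Fin (Module.finrank Fq K) => F.map (frob Fq i)

/-- `F_* = gcd(F^⊥, θ_1(F)^⊥, …, θ_{m-1}(F)^⊥)^⊤`. -/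
def lowerStar (r n : ℕ) (F : K[X]) : K[X] :=
  linTop (Fintype.card Fq ^ r) n <| rightGcd (Fintype.card Fq ^ r)
    fun i : Fin (Module.finrank Fq K) => linPerp (Fintype.card Fq ^ r) (F.map (frob Fq i))

/-- `F_0 = lcm(F^⊥, θ_1(F)^⊥, …, θ_{m-1}(F)^⊥)^⊤`. -/
def lowerZero (r n : ℕ) (F : K[X]) : K[X] :=
  linTop (Fintype.card Fq ^ r) n <| rightLcm (Fintype.card Fq ^ r)
    fun i : Fin (Module.finrank Fq K) => linPerp (Fintype.card Fq ^ r) (F.map (frob Fq i))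

variable {n : ℕ}

/-- `F` is a `Q`-linearized polynomial whose residue class modulo `x ^ (Q ^ n) - x` is the class of
`c_0 x + c_1 x ^ Q + ⋯ + c_{n-1} x ^ (Q ^ (n-1))` for some codeword `c`. -/
def InSkewIdeal {K : Type*} [Field K] (Q : ℕ) (C : Submodule K (Fin n → K)) (F : K[X]) : Prop :=
  IsLinearized Q F ∧ ∃ c ∈ C, ∃ P : K[X], IsLinearized Q P ∧
    F = ∑ i : Fin n, Polynomial.C (c i) * X ^ (Q ^ (i : ℕ)) + P.comp (X ^ (Q ^ n) - X)

/-- `G` and `H` are the generator and check polynomials of the linear `q ^ r`-cyclic code `C`: `G`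
is monic and of minimal degree among the nonzero `q ^ r`-linearized polynomials whose class
corresponds to a codeword, and `x ^ (q ^ (r n)) - x = G ⊗ H = H ⊗ G`. -/
structure IsSkewGenCheck [NeZero n] (r : ℕ) (C : Submodule K (Fin n → K)) (G H : K[X]) :
    Prop where
  skewCyclic : IsSkewCyclic Fq r C
  monic : G.Monic
  mem : InSkewIdeal (Fintype.card Fq ^ r) C G
  minimal : ∀ F : K[X], InSkewIdeal (Fintype.card Fq ^ r) C F → F ≠ 0 →
    G.natDegree ≤ F.natDegree
  linearized : IsLinearized (Fintype.card Fq ^ r) H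
  comp_eq : G.comp H = X ^ (Fintype.card Fq ^ (r * n)) - X
  comp_eq' : H.comp G = X ^ (Fintype.card Fq ^ (r * n)) - X

end SkewGenerators

end SkewCyclic

end

open SkewCyclic

/-!
Put `Q = q ^ r`. Residue classes modulo `x ^ (Q ^ n) - x` identify the `q ^ r`-cyclic codes with the
left ideals of linearized polynomials that contain `x ^ (Q ^ n) - x`, and right division shows that
each of them is generated by its monic polynomial of minimal degree. Hence sums of codes correspond
to greatest common right divisors of the generators, and intersections to least common multiples.

The generator of the dual code is `H^⊥`, where `H` is the check polynomial: in `P ⊗ G ⊗ H`, a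
suitable coefficient is, up to a unit, the inner product of the codeword `P ⊗ G` with the
coefficients of `H^⊥`. Duality exchanges sums and intersections, and `⊤` inverts `⊥` on check
polynomials; this yields the check polynomials of `C^*` and `C^0`.

Finally, a `q ^ r`-cyclic code that is stable under every `θ_s` is cyclic, and by uniqueness of its
generator and check polynomials `G` and `H` these have coefficients fixed by `a ↦ a ^ Q`. On
polynomials with such coefficients `L` turns products into compositions, so that `G` and `H` are the
images under `L` of the conventional generator and check polynomials.
-/

namespace SkewCyclic

/-- `Q > 1` is a power of the characteristic of `K`, so that raising to the power `Q` is an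
injective additive map on `K`. -/
class IsFrobeniusPower (K : Type*) [Field K] (Q : ℕ) : Prop where
  one_lt : 1 < Q
  exists_eq_pow : ∃ p k : ℕ, p.Prime ∧ CharP K p ∧ Q = p ^ k

section FrobeniusPower

theorem IsFrobeniusPower.pos (K : Type*) [Field K] (Q : ℕ) [IsFrobeniusPower K Q] : 0 < Q :=
  zero_lt_one.trans (one_lt K)

theorem IsFrobeniusPower.pow_ne_zero (K : Type*) [Field K] (Q : ℕ) [IsFrobeniusPower K Q]
    (i : ℕ) : Q ^ i ≠ 0 :=
  (pow_pos (pos K Q) i).ne'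

theorem IsFrobeniusPower.one_lt_pow (K : Type*) [Field K] (Q : ℕ) [IsFrobeniusPower K Q]
    (n : ℕ) [NeZero n] : 1 < Q ^ n :=
  Nat.one_lt_pow (NeZero.ne n) (one_lt K)

theorem IsFrobeniusPower.pow_right_inj (K : Type*) [Field K] {Q : ℕ} [IsFrobeniusPower K Q]
    {i j : ℕ} : Q ^ i = Q ^ j ↔ i = j :=
  (Nat.pow_right_injective (one_lt K)).eq_iff

variable (K : Type*) [Field K] (Q : ℕ) [IsFrobeniusPower K Q]

/-- The Frobenius endomorphism `a ↦ a ^ (Q ^ i)` of a commutative `K`-algebra. -/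
def powHom (R : Type*) [CommRing R] [Algebra K R] (i : ℕ) : R →+* R where
  toFun a := a ^ Q ^ i
  map_one' := one_pow _
  map_mul' a b := mul_pow a b _
  map_zero' := zero_pow (IsFrobeniusPower.pow_ne_zero K Q i)
  map_add' a b := by
    obtain ⟨p, k, hp, hchar, rfl⟩ := IsFrobeniusPower.exists_eq_pow (K := K) (Q := Q)
    have := Fact.mk hp
    cases subsingleton_or_nontrivial R
    · exact Subsingleton.elim _ _
    · have := charP_of_injective_algebraMap (algebraMap K R).injective p
      rw [← pow_mul]
      exact add_pow_char_pow a b p _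

theorem powHom_apply {R : Type*} [CommRing R] [Algebra K R] (i : ℕ) (a : R) :
    powHom K Q R i a = a ^ Q ^ i := rfl

theorem powHom_one_apply {R : Type*} [CommRing R] [Algebra K R] (a : R) :
    powHom K Q R 1 a = a ^ Q := by rw [powHom_apply, pow_one]

end FrobeniusPower

section Linearized

variable {K : Type*} [Field K] {Q : ℕ} {F G : K[X]}

theorem linCoeff_add (F G : K[X]) (i : ℕ) :
    linCoeff Q (F + G) i = linCoeff Q F i + linCoeff Q G i := coeff_add _ _ _

theorem linCoeff_sub (F G : K[X]) (i : ℕ) :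
    linCoeff Q (F - G) i = linCoeff Q F i - linCoeff Q G i := coeff_sub _ _ _

theorem linCoeff_C_mul (a : K) (F : K[X]) (i : ℕ) :
    linCoeff Q (C a * F) i = a * linCoeff Q F i := coeff_C_mul _

theorem linCoeff_sum {ι : Type*} (s : Finset ι) (F : ι → K[X]) (i : ℕ) :
    linCoeff Q (∑ j ∈ s, F j) i = ∑ j ∈ s, linCoeff Q (F j) i := finsetSum_coeff _ _ _

theorem linCoeff_X_pow [IsFrobeniusPower K Q] (i j : ℕ) :
    linCoeff Q (X ^ Q ^ i : K[X]) j = if j = i then 1 else 0 := by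
  simp only [linCoeff, coeff_X_pow, IsFrobeniusPower.pow_right_inj K]

theorem isLinearized_X_pow (i : ℕ) : IsLinearized Q (X ^ Q ^ i : K[X]) := fun k hk =>
  ⟨i, by by_contra h; exact hk (by rw [coeff_X_pow, if_neg h])⟩

theorem isLinearized_X : IsLinearized Q (X : K[X]) := by
  simpa only [pow_zero, pow_one] using isLinearized_X_pow (K := K) (Q := Q) 0

namespace IsLinearized

theorem zero : IsLinearized Q (0 : K[X]) := fun k h => absurd (coeff_zero k) h

theorem add (hF : IsLinearized Q F) (hG : IsLinearized Q G) : IsLinearized Q (F + G) := by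
  intro k hk
  by_cases h : F.coeff k = 0
  · exact hG k (by simpa [h] using hk)
  · exact hF k h

theorem C_mul (hF : IsLinearized Q F) (a : K) : IsLinearized Q (C a * F) := fun k hk =>
  hF k (right_ne_zero_of_mul (by rwa [coeff_C_mul] at hk))

theorem sub (hF : IsLinearized Q F) (hG : IsLinearized Q G) : IsLinearized Q (F - G) := by
  simpa only [C_neg, C_1, neg_one_mul, ← sub_eq_add_neg] using hF.add (hG.C_mul (-1))

theorem sum {ι : Type*} (s : Finset ι) {F : ι → K[X]} (h : ∀ i ∈ s, IsLinearized Q (F i)) :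
    IsLinearized Q (∑ i ∈ s, F i) :=
  Finset.sum_induction F (IsLinearized Q) (fun _ _ => add) zero h

@[elab_as_elim]
theorem induction {motive : ∀ F : K[X], IsLinearized Q F → Prop}
    (add : ∀ F G hF hG, motive F hF → motive G hG → motive (F + G) (hF.add hG))
    (C_mul_X_pow : ∀ a i, motive (C a * X ^ Q ^ i) ((isLinearized_X_pow i).C_mul a))
    (hF : IsLinearized Q F) : motive F hF := by
  suffices h : ∃ h, motive (F.sum fun k a => C a * X ^ k) h by
    simp only [sum_C_mul_X_pow_eq] at h
    exact h.2
  refine Finset.sum_induction _ (fun G => ∃ h, motive G h) ?_ ?_ fun k hk => ?_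
  · exact fun F G ⟨hF, hmF⟩ ⟨hG, hmG⟩ => ⟨hF.add hG, add F G hF hG hmF hmG⟩
  · simpa only [C_0, zero_mul] using Exists.intro _ (C_mul_X_pow 0 0)
  · obtain ⟨i, rfl⟩ := hF k (mem_support_iff.mp hk)
    exact ⟨_, C_mul_X_pow _ i⟩

theorem ext (hF : IsLinearized Q F) (hG : IsLinearized Q G)
    (h : ∀ i, linCoeff Q F i = linCoeff Q G i) : F = G := by
  ext k
  by_contra hk
  obtain ⟨i, rfl⟩ := hF.sub hG k (by rwa [coeff_sub, sub_ne_zero])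
  exact hk (h i)

section Degree

variable [IsFrobeniusPower K Q]

theorem coeff_zero (hF : IsLinearized Q F) : F.coeff 0 = 0 := by
  by_contra h
  obtain ⟨i, hi⟩ := hF 0 h
  exact IsFrobeniusPower.pow_ne_zero K Q i hi.symm

theorem natDegree_eq (hF : IsLinearized Q F) (h0 : F ≠ 0) :
    F.natDegree = Q ^ linDegree Q F := by
  obtain ⟨d, hd⟩ := hF _ (leadingCoeff_ne_zero.mpr h0)
  rw [linDegree, hd, Nat.log_pow (IsFrobeniusPower.one_lt K)]

theorem natDegree_ne_zero (hF : IsLinearized Q F) (h0 : F ≠ 0) : F.natDegree ≠ 0 := by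
  rw [hF.natDegree_eq h0]
  exact IsFrobeniusPower.pow_ne_zero K Q _

theorem linCoeff_linDegree (hF : IsLinearized Q F) (h0 : F ≠ 0) :
    linCoeff Q F (linDegree Q F) = F.leadingCoeff := by
  rw [linCoeff, ← hF.natDegree_eq h0, leadingCoeff]

theorem linCoeff_eq_zero_of_linDegree_lt (hF : IsLinearized Q F) {i : ℕ}
    (hi : linDegree Q F < i) : linCoeff Q F i = 0 := by
  rcases eq_or_ne F 0 with rfl | h0
  · exact Polynomial.coeff_zero _
  · refine coeff_eq_zero_of_natDegree_lt ?_
    rw [hF.natDegree_eq h0]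
    exact Nat.pow_lt_pow_right (IsFrobeniusPower.one_lt K) hi

theorem eq_X (hF : IsLinearized Q F) (hm : F.Monic) (h : F.natDegree = 1) : F = X := by
  rw [hm.eq_X_add_C h, hF.coeff_zero, C_0, add_zero]

end Degree

end IsLinearized

theorem linDegree_eq_of_natDegree_eq [IsFrobeniusPower K Q] {d : ℕ} (h : F.natDegree = Q ^ d) :
    linDegree Q F = d := by
  rw [linDegree, h, Nat.log_pow (IsFrobeniusPower.one_lt K)]

section Composition

theorem monic_of_monic_comp (hG : G.Monic) (hG0 : G.natDegree ≠ 0) (h : (F.comp G).Monic) :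
    F.Monic := by
  rwa [Monic, leadingCoeff_comp hG0, hG.leadingCoeff, one_pow, mul_one] at h

theorem comp_left_injective {D : K[X]} (hD : D.natDegree ≠ 0) :
    Function.Injective fun A : K[X] => A.comp D := fun A B h => by
  have h0 : (A - B).comp D = 0 := by rw [sub_comp, sub_eq_zero]; exact h
  rcases comp_eq_zero_iff.mp h0 with h | ⟨-, h⟩
  · exact sub_eq_zero.mp h
  · exact absurd (h ▸ natDegree_C _) hD

variable [IsFrobeniusPower K Q]

namespace IsLinearized

theorem pow (hF : IsLinearized Q F) (i : ℕ) : IsLinearized Q (F ^ Q ^ i) := by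
  induction hF using IsLinearized.induction with
  | add F G _ _ hF hG =>
    rw [← powHom_apply K, map_add]
    exact hF.add hG
  | C_mul_X_pow a j =>
    rw [mul_pow, ← C_pow, ← pow_mul, ← pow_add]
    exact (isLinearized_X_pow _).C_mul _

theorem linCoeff_pow (hF : IsLinearized Q F) (i k : ℕ) :
    linCoeff Q (F ^ Q ^ i) k = if i ≤ k then linCoeff Q F (k - i) ^ Q ^ i else 0 := by
  induction hF using IsLinearized.induction with
  | add F G _ _ hF hG =>
    simp only [← powHom_apply K, map_add, linCoeff_add] at hF hG ⊢
    rw [hF, hG]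
    split_ifs <;> simp
  | C_mul_X_pow a j =>
    simp only [mul_pow, ← C_pow, ← pow_mul, ← pow_add, linCoeff_C_mul, linCoeff_X_pow]
    by_cases h : i ≤ k
    · have : k = j + i ↔ k - i = j := by omega
      simp [h, this, IsFrobeniusPower.pos K Q |>.ne']
    · simp [h, show k ≠ j + i by omega]

theorem comp (hF : IsLinearized Q F) (hG : IsLinearized Q G) : IsLinearized Q (F.comp G) := by
  induction hF using IsLinearized.induction with
  | add F F' _ _ hF hF' =>
    rw [add_comp]
    exact hF.add hF'
  | C_mul_X_pow a i =>
    rw [mul_comp, C_comp, X_pow_comp]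
    exact (hG.pow i).C_mul a

theorem comp_add (hF : IsLinearized Q F) (A B : K[X]) :
    F.comp (A + B) = F.comp A + F.comp B := by
  induction hF using IsLinearized.induction with
  | add F G _ _ hF hG =>
    simp only [add_comp, hF, hG]
    ring
  | C_mul_X_pow a i =>
    simp only [mul_comp, C_comp, X_pow_comp]
    rw [← powHom_apply K, map_add, mul_add]
    rfl

theorem comp_sub (hF : IsLinearized Q F) (A B : K[X]) :
    F.comp (A - B) = F.comp A - F.comp B := by
  rw [eq_sub_iff_add_eq, ← hF.comp_add, sub_add_cancel]

theorem linDegree_comp (hF : IsLinearized Q F) (hG : IsLinearized Q G) (h : F.comp G ≠ 0) :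
    linDegree Q (F.comp G) = linDegree Q F + linDegree Q G := by
  have hF0 : F ≠ 0 := by
    rintro rfl
    exact h zero_comp
  have hG0 : G ≠ 0 := by
    rintro rfl
    exact h (by rw [comp_zero, ← coeff_zero_eq_eval_zero, hF.coeff_zero, C_0])
  apply linDegree_eq_of_natDegree_eq
  rw [natDegree_comp, hF.natDegree_eq hF0, hG.natDegree_eq hG0, pow_add]

theorem linCoeff_comp_zero (hF : IsLinearized Q F) (hG : IsLinearized Q G) :
    linCoeff Q (F.comp G) 0 = linCoeff Q F 0 * linCoeff Q G 0 := by
  induction hF using IsLinearized.induction with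
  | add F F' _ _ hF hF' => rw [add_comp, linCoeff_add, linCoeff_add, hF, hF', add_mul]
  | C_mul_X_pow a i =>
    rw [mul_comp, C_comp, X_pow_comp, linCoeff_C_mul, linCoeff_C_mul, linCoeff_X_pow,
      hG.linCoeff_pow]
    rcases i.eq_zero_or_pos with rfl | hi
    · simp
    · simp [hi.ne, hi.ne']

theorem exists_degree_sub_comp_lt {D : K[X]} (hD : IsLinearized Q D) (hD0 : D ≠ 0)
    (hF : IsLinearized Q F) (hF0 : F ≠ 0) (hle : D.degree ≤ F.degree) :
    ∃ T, IsLinearized Q T ∧ (F - T.comp D).degree < F.degree := by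
  set k := linDegree Q F - linDegree Q D with hk
  have hpow : D.natDegree * Q ^ k = F.natDegree := by
    have := natDegree_le_natDegree hle
    rw [hD.natDegree_eq hD0, hF.natDegree_eq hF0,
      Nat.pow_le_pow_iff_right (IsFrobeniusPower.one_lt K)] at this
    rw [hD.natDegree_eq hD0, hF.natDegree_eq hF0, ← pow_add, hk, Nat.add_sub_cancel' this]
  have hlc : D.leadingCoeff ^ Q ^ k ≠ 0 := pow_ne_zero _ (leadingCoeff_ne_zero.mpr hD0)
  have hT0 : F.leadingCoeff / D.leadingCoeff ^ Q ^ k ≠ 0 :=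
    div_ne_zero (leadingCoeff_ne_zero.mpr hF0) hlc
  refine ⟨C (F.leadingCoeff / D.leadingCoeff ^ Q ^ k) * X ^ Q ^ k,
    (isLinearized_X_pow k).C_mul _, ?_⟩
  rw [mul_comp, C_comp, X_pow_comp]
  refine degree_sub_lt_left ?_ hF0 ?_
  · rw [degree_C_mul hT0, degree_pow, degree_eq_natDegree hF0, degree_eq_natDegree hD0, ← hpow]
    simp [mul_comm]
  · rw [leadingCoeff_mul, leadingCoeff_C, leadingCoeff_pow, div_mul_cancel₀ _ hlc]

theorem exists_comp_add_eq {D : K[X]} (hD : IsLinearized Q D) (hD0 : D ≠ 0)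
    (hF : IsLinearized Q F) :
    ∃ P R, IsLinearized Q P ∧ IsLinearized Q R ∧ P.comp D + R = F ∧ R.degree < D.degree := by
  induction h : F.degree using WellFoundedLT.induction generalizing F with
  | _ d ih =>
    rcases lt_or_ge F.degree D.degree with hlt | hle
    · exact ⟨0, F, zero, hF, by rw [zero_comp, zero_add], hlt⟩
    have hF0 : F ≠ 0 := by
      rintro rfl
      exact hD0 (degree_eq_bot.mp (le_bot_iff.mp (degree_zero (R := K) ▸ hle)))
    obtain ⟨T, hT, hlt⟩ := hD.exists_degree_sub_comp_lt hD0 hF hF0 hle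
    obtain ⟨P, R, hP, hR, heq, hdeg⟩ := ih _ (h ▸ hlt) (hF.sub (hT.comp hD)) rfl
    exact ⟨P + T, R, hP.add hT, hR, by rw [add_comp, add_right_comm, heq, sub_add_cancel], hdeg⟩

end IsLinearized

end Composition

section RightDivisibility

variable {A B D : K[X]}

theorem RightDvd.add (h : RightDvd Q A B) (h' : RightDvd Q A D) : RightDvd Q A (B + D) := by
  obtain ⟨P, hP, rfl⟩ := h
  obtain ⟨P', hP', rfl⟩ := h'
  exact ⟨P + P', hP.add hP', add_comp.symm⟩

variable [IsFrobeniusPower K Q]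

theorem RightDvd.trans (h : RightDvd Q A B) (h' : RightDvd Q B D) : RightDvd Q A D := by
  obtain ⟨P, hP, rfl⟩ := h
  obtain ⟨P', hP', rfl⟩ := h'
  exact ⟨P'.comp P, hP'.comp hP, (comp_assoc _ _ _).symm⟩

theorem RightDvd.antisymm (hA : A.Monic) (hB : B.Monic) (hlin : IsLinearized Q B)
    (h : RightDvd Q A B) (h' : RightDvd Q B A) : A = B := by
  obtain ⟨P, -, hPA⟩ := h
  obtain ⟨P', hP', rfl⟩ := h'
  have hB0 := hlin.natDegree_ne_zero hB.ne_zero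
  have hdeg : P.natDegree * P'.natDegree = 1 := by
    have := congrArg natDegree hPA
    rw [natDegree_comp, natDegree_comp, ← mul_assoc] at this
    exact Nat.eq_of_mul_eq_mul_right (Nat.pos_of_ne_zero hB0) (by rw [← this, one_mul])
  rw [hP'.eq_X (monic_of_monic_comp hB hB0 hA) (Nat.eq_one_of_mul_eq_one_left hdeg), X_comp]

variable {ι : Type*} {S : ι → K[X]}

theorem IsRightGcd.unique (hA : IsRightGcd Q S A) (hB : IsRightGcd Q S B) : A = B :=
  RightDvd.antisymm hA.monic hB.monic hB.linearized (hB.greatest _ hA.linearized hA.dvd)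
    (hA.greatest _ hB.linearized hB.dvd)

theorem IsRightLcm.unique (hA : IsRightLcm Q S A) (hB : IsRightLcm Q S B) : A = B :=
  RightDvd.antisymm hA.monic hB.monic hB.linearized (hA.least _ hB.linearized hB.dvd)
    (hB.least _ hA.linearized hA.dvd)

theorem IsRightGcd.rightGcd_eq (hD : IsRightGcd Q S D) : rightGcd Q S = D := by
  have h : ∃ D, IsRightGcd Q S D := ⟨D, hD⟩
  rw [rightGcd, dif_pos h]
  exact h.choose_spec.unique hD

theorem IsRightLcm.rightLcm_eq (hD : IsRightLcm Q S D) : rightLcm Q S = D := by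
  have h : ∃ D, IsRightLcm Q S D := ⟨D, hD⟩
  rw [rightLcm, dif_pos h]
  exact h.choose_spec.unique hD

end RightDivisibility

section Linearize

theorem isLinearized_linearize (f : K[X]) : IsLinearized Q (linearize Q f) :=
  IsLinearized.sum _ fun i _ => (isLinearized_X_pow i).C_mul _

theorem linearize_monomial (i : ℕ) (a : K) :
    linearize Q (monomial i a) = C a * X ^ Q ^ i :=
  sum_monomial_index a _ (by rw [C_0, zero_mul])

theorem linearize_add (f g : K[X]) :
    linearize Q (f + g) = linearize Q f + linearize Q g :=
  sum_add_index f g _ (fun i => by rw [C_0, zero_mul]) fun i a b => by rw [C_add, add_mul]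

theorem IsLinearized.exists_linearize_eq (hF : IsLinearized Q F) : ∃ f, linearize Q f = F := by
  induction hF using IsLinearized.induction with
  | add F G _ _ hF hG =>
    obtain ⟨f, rfl⟩ := hF
    obtain ⟨g, rfl⟩ := hG
    exact ⟨f + g, linearize_add f g⟩
  | C_mul_X_pow a i => exact ⟨monomial i a, linearize_monomial i a⟩

variable [IsFrobeniusPower K Q]

theorem linCoeff_linearize (f : K[X]) (i : ℕ) : linCoeff Q (linearize Q f) i = f.coeff i := by
  simp only [linearize, sum_def, linCoeff_sum, linCoeff_C_mul, linCoeff_X_pow]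
  simp +contextual [eq_comm]

theorem linearize_injective : Function.Injective (linearize Q : K[X] → K[X]) := fun f g h =>
  Polynomial.ext fun i => by rw [← linCoeff_linearize (Q := Q), h, linCoeff_linearize]

theorem linearize_ne_zero {f : K[X]} (hf : f ≠ 0) : linearize Q f ≠ 0 := by
  rw [← sum_zero_index (f := fun i (a : K) => C a * X ^ Q ^ i)]
  exact linearize_injective.ne hf

theorem natDegree_linearize {f : K[X]} (hf : f ≠ 0) :
    (linearize Q f).natDegree = Q ^ f.natDegree := by
  refine natDegree_eq_of_le_of_coeff_ne_zero ?_ ?_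
  · refine natDegree_le_iff_coeff_eq_zero.mpr fun k hk => ?_
    by_contra h
    obtain ⟨i, rfl⟩ := isLinearized_linearize f k h
    rw [← linCoeff, linCoeff_linearize] at h
    exact hk.not_ge (Nat.pow_le_pow_right (IsFrobeniusPower.pos K Q) (le_natDegree_of_ne_zero h))
  · rw [← linCoeff, linCoeff_linearize]
    exact leadingCoeff_ne_zero.mpr hf

theorem monic_linearize_iff {f : K[X]} : (linearize Q f).Monic ↔ f.Monic := by
  rcases eq_or_ne f 0 with rfl | hf
  · simp [linearize]
  · rw [Monic, leadingCoeff, natDegree_linearize hf, ← linCoeff, linCoeff_linearize]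
    rfl

theorem linearize_mul (f : K[X]) {h : K[X]} (hh : ∀ i, h.coeff i ^ Q = h.coeff i) :
    linearize Q (f * h) = (linearize Q f).comp (linearize Q h) := by
  have hpow : ∀ i j, h.coeff j ^ Q ^ i = h.coeff j := by
    intro i j
    induction i with
    | zero => rw [pow_zero, pow_one]
    | succ i ih => rw [pow_succ, pow_mul, ih, hh]
  induction f using Polynomial.induction_on' with
  | add f g hf hg => rw [add_mul, linearize_add, linearize_add, add_comp, hf, hg]
  | monomial i a =>
    refine (isLinearized_linearize _).ext
      ((isLinearized_linearize _).comp (isLinearized_linearize _)) fun k => ?_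
    rw [linearize_monomial, mul_comp, C_comp, X_pow_comp, linCoeff_C_mul,
      (isLinearized_linearize h).linCoeff_pow, linCoeff_linearize, linCoeff_linearize,
      ← C_mul_X_pow_eq_monomial, mul_assoc, coeff_C_mul, coeff_X_pow_mul', hpow]

end Linearize

end Linearized

section Modulus

variable {K : Type*} [Field K] {Q n : ℕ} {F G H : K[X]}

theorem isLinearized_X_pow_sub_X : IsLinearized Q (X ^ Q ^ n - X : K[X]) :=
  (isLinearized_X_pow n).sub isLinearized_X

variable [IsFrobeniusPower K Q]

theorem linCoeff_X_pow_sub_X (i : ℕ) :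
    linCoeff Q (X ^ Q ^ n - X : K[X]) i = (if i = n then 1 else 0) - if i = 0 then 1 else 0 := by
  have hX := linCoeff_X_pow (K := K) (Q := Q) 0 i
  rw [pow_zero, pow_one] at hX
  rw [linCoeff_sub, linCoeff_X_pow, hX]

theorem IsLinearized.comp_X_pow_sub_X (hK : ∀ a : K, a ^ Q ^ n = a) (hF : IsLinearized Q F) :
    F.comp (X ^ Q ^ n - X) = (X ^ Q ^ n - X : K[X]).comp F := by
  rw [hF.comp_sub, comp_X, sub_comp, X_pow_comp, X_comp, sub_left_inj]
  induction hF using IsLinearized.induction with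
  | add A B _ _ hA hB =>
    rw [add_comp, hA, hB]
    exact (map_add (powHom K Q K[X] n) A B).symm
  | C_mul_X_pow a i => rw [mul_comp, C_comp, X_pow_comp, mul_pow, ← C_pow, hK, pow_right_comm]

variable [NeZero n]

theorem natDegree_X_pow_sub_X : (X ^ Q ^ n - X : K[X]).natDegree = Q ^ n :=
  FiniteField.X_pow_card_pow_sub_X_natDegree_eq K (NeZero.ne n) (IsFrobeniusPower.one_lt K)

theorem monic_X_pow_sub_X : (X ^ Q ^ n - X : K[X]).Monic :=
  monic_X_pow_sub (by rw [degree_X]; exact_mod_cast IsFrobeniusPower.one_lt_pow K Q n)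

theorem ne_zero_of_comp_eq_X_pow_sub_X (hF : IsLinearized Q F)
    (h : F.comp G = X ^ Q ^ n - X) : F ≠ 0 ∧ G ≠ 0 := by
  constructor
  · rintro rfl
    exact (monic_X_pow_sub_X (K := K) (Q := Q) (n := n)).ne_zero (by rw [← h, zero_comp])
  · rintro rfl
    refine (monic_X_pow_sub_X (K := K) (Q := Q) (n := n)).ne_zero ?_
    rw [← h, comp_zero, ← coeff_zero_eq_eval_zero, hF.coeff_zero, C_0]

theorem comp_eq_X_pow_sub_X_symm (hK : ∀ a : K, a ^ Q ^ n = a) (hF : IsLinearized Q F)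
    (hG : IsLinearized Q G) (h : F.comp G = X ^ Q ^ n - X) : G.comp F = X ^ Q ^ n - X := by
  refine comp_left_injective (hG.natDegree_ne_zero (ne_zero_of_comp_eq_X_pow_sub_X hF h).2) ?_
  change (G.comp F).comp G = (X ^ Q ^ n - X : K[X]).comp G
  rw [comp_assoc, h, hG.comp_X_pow_sub_X hK]

theorem linDegree_add_linDegree (hF : IsLinearized Q F) (hG : IsLinearized Q G)
    (h : F.comp G = X ^ Q ^ n - X) : linDegree Q F + linDegree Q G = n := by
  rw [← hF.linDegree_comp hG (h ▸ monic_X_pow_sub_X.ne_zero), h]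
  exact linDegree_eq_of_natDegree_eq natDegree_X_pow_sub_X

theorem linCoeff_zero_ne_zero_of_comp_eq (hF : IsLinearized Q F) (hG : IsLinearized Q G)
    (h : F.comp G = X ^ Q ^ n - X) : linCoeff Q F 0 ≠ 0 ∧ linCoeff Q G 0 ≠ 0 := by
  rw [← mul_ne_zero_iff, ← hF.linCoeff_comp_zero hG, h, linCoeff_X_pow_sub_X,
    if_neg (NeZero.ne n).symm, if_pos rfl, zero_sub]
  exact neg_ne_zero.mpr one_ne_zero

end Modulus

section Codewords

variable {K : Type*} [Field K] {Q n : ℕ}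

/-- The linearized polynomial `c_0 x + c_1 x ^ Q + ⋯ + c_{n-1} x ^ (Q ^ (n-1))` of a word. -/
noncomputable def codewordPoly (Q : ℕ) : (Fin n → K) →ₗ[K] K[X] :=
  Fintype.linearCombination K fun i : Fin n => X ^ Q ^ (i : ℕ)

theorem codewordPoly_apply (c : Fin n → K) :
    codewordPoly Q c = ∑ i : Fin n, C (c i) * X ^ Q ^ (i : ℕ) := by
  simp only [codewordPoly, Fintype.linearCombination_apply, smul_eq_C_mul]

theorem isLinearized_codewordPoly (c : Fin n → K) : IsLinearized Q (codewordPoly Q c) := by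
  rw [codewordPoly_apply]
  exact IsLinearized.sum _ fun i _ => (isLinearized_X_pow _).C_mul _

variable [IsFrobeniusPower K Q]

theorem linCoeff_codewordPoly (c : Fin n → K) (i : Fin n) :
    linCoeff Q (codewordPoly Q c) i = c i := by
  simp [codewordPoly_apply, linCoeff_sum, linCoeff_C_mul, linCoeff_X_pow, Fin.val_inj]

theorem linCoeff_codewordPoly_of_le (c : Fin n → K) {k : ℕ} (hk : n ≤ k) :
    linCoeff Q (codewordPoly Q c) k = 0 := by
  rw [codewordPoly_apply, linCoeff_sum]
  refine Finset.sum_eq_zero fun i _ => ?_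
  rw [linCoeff_C_mul, linCoeff_X_pow, if_neg (i.2.trans_le hk).ne', mul_zero]

theorem codewordPoly_injective :
    Function.Injective (codewordPoly Q : (Fin n → K) →ₗ[K] K[X]) := fun c c' h =>
  funext fun i => by rw [← linCoeff_codewordPoly (Q := Q) c, h, linCoeff_codewordPoly]

theorem IsLinearized.codewordPoly_linCoeff {F : K[X]} (hF : IsLinearized Q F)
    (h : F.natDegree < Q ^ n) : codewordPoly Q (fun i : Fin n => linCoeff Q F i) = F := by
  refine (isLinearized_codewordPoly _).ext hF fun k => ?_
  rcases lt_or_ge k n with hk | hk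
  · exact linCoeff_codewordPoly _ ⟨k, hk⟩
  · rw [linCoeff_codewordPoly_of_le _ hk]
    exact (coeff_eq_zero_of_natDegree_lt
      (h.trans_le (Nat.pow_le_pow_right (IsFrobeniusPower.pos K Q) hk))).symm

theorem natDegree_codewordPoly_lt (c : Fin n → K) : (codewordPoly Q c).natDegree < Q ^ n := by
  rcases eq_or_ne (codewordPoly Q c) 0 with h0 | h0
  · rw [h0, natDegree_zero]
    exact (pow_pos (IsFrobeniusPower.pos K Q) n)
  have hlin := isLinearized_codewordPoly (Q := Q) c
  rw [hlin.natDegree_eq h0]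
  refine Nat.pow_lt_pow_right (IsFrobeniusPower.one_lt K) (not_le.mp fun h => ?_)
  exact leadingCoeff_ne_zero.mpr h0 <|
    hlin.linCoeff_linDegree h0 ▸ linCoeff_codewordPoly_of_le c h

variable [NeZero n]

theorem eq_of_codewordPoly_add_comp_eq {c c' : Fin n → K} {P P' : K[X]} (hP : IsLinearized Q P)
    (hP' : IsLinearized Q P') (h : codewordPoly Q c + P.comp (X ^ Q ^ n - X) =
      codewordPoly Q c' + P'.comp (X ^ Q ^ n - X)) : c = c' := by
  have hdiff : (P - P').comp (X ^ Q ^ n - X) = codewordPoly Q (c' - c) := by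
    rw [sub_comp, map_sub]
    linear_combination h
  have hlt := natDegree_codewordPoly_lt (Q := Q) (c' - c)
  rw [← hdiff, natDegree_comp, natDegree_X_pow_sub_X] at hlt
  have hPP : P - P' = 0 := by
    by_contra hne
    have hpos := Nat.pos_of_ne_zero ((hP.sub hP').natDegree_ne_zero hne)
    exact hlt.not_ge (Nat.le_mul_of_pos_left _ hpos)
  rw [hPP, zero_comp, eq_comm, map_sub, sub_eq_zero] at hdiff
  exact (codewordPoly_injective hdiff).symm

theorem codewordPoly_pow (c : Fin n → K) :
    codewordPoly Q c ^ Q =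
      codewordPoly Q (shift c ^ Q) + C (shift c 0 ^ Q) * (X ^ Q ^ n - X) := by
  obtain ⟨m, rfl⟩ := Nat.exists_eq_add_one_of_ne_zero (NeZero.ne n)
  have hlast : shift c 0 = c (Fin.last m) :=
    congrArg c (sub_eq_of_eq_add (Fin.last_add_one m).symm)
  have hsucc (i : Fin m) : shift c i.succ = c i.castSucc :=
    congrArg c (sub_eq_of_eq_add Fin.coeSucc_eq_succ.symm)
  rw [codewordPoly_apply, codewordPoly_apply, ← powHom_one_apply K, map_sum,
    Fin.sum_univ_castSucc, Fin.sum_univ_succ]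
  simp only [map_mul, powHom_one_apply, ← C_pow, ← pow_mul, ← pow_succ, Fin.val_castSucc,
    Fin.val_last, Pi.pow_apply, hlast, hsucc, Fin.val_zero, Fin.val_succ]
  ring

end Codewords

section Ideal

variable {K : Type*} [Field K] {Q n : ℕ} {D D' : Submodule K (Fin n → K)} {F G : K[X]}

theorem inSkewIdeal_iff : InSkewIdeal Q D F ↔ IsLinearized Q F ∧ ∃ c ∈ D, ∃ P : K[X],
    IsLinearized Q P ∧ F = codewordPoly Q c + P.comp (X ^ Q ^ n - X) := by
  simp only [codewordPoly_apply]
  rfl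

theorem inSkewIdeal_X_pow_sub_X (D : Submodule K (Fin n → K)) :
    InSkewIdeal Q D (X ^ Q ^ n - X) :=
  inSkewIdeal_iff.mpr ⟨isLinearized_X_pow_sub_X, 0, D.zero_mem, X, isLinearized_X, by
    rw [map_zero, X_comp, zero_add]⟩

theorem InSkewIdeal.add (hF : InSkewIdeal Q D F) (hG : InSkewIdeal Q D G) :
    InSkewIdeal Q D (F + G) := by
  rw [inSkewIdeal_iff] at *
  obtain ⟨hl, c, hc, P, hP, rfl⟩ := hF
  obtain ⟨hl', c', hc', P', hP', rfl⟩ := hG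
  refine ⟨hl.add hl', c + c', D.add_mem hc hc', P + P', hP.add hP', ?_⟩
  rw [map_add, add_comp, add_add_add_comm]

theorem InSkewIdeal.C_mul (hF : InSkewIdeal Q D F) (a : K) : InSkewIdeal Q D (C a * F) := by
  rw [inSkewIdeal_iff] at *
  obtain ⟨hl, c, hc, P, hP, rfl⟩ := hF
  refine ⟨hl.C_mul a, a • c, D.smul_mem a hc, C a * P, hP.C_mul a, ?_⟩
  rw [map_smul, smul_eq_C_mul, mul_comp, C_comp, mul_add]

theorem InSkewIdeal.sub (hF : InSkewIdeal Q D F) (hG : InSkewIdeal Q D G) :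
    InSkewIdeal Q D (F - G) := by
  simpa only [C_neg, C_1, neg_one_mul, ← sub_eq_add_neg] using hF.add (hG.C_mul (-1))

theorem InSkewIdeal.mono (h : D ≤ D') (hF : InSkewIdeal Q D F) : InSkewIdeal Q D' F := by
  obtain ⟨hl, c, hc, P⟩ := hF
  exact ⟨hl, c, h hc, P⟩

variable [IsFrobeniusPower K Q] [NeZero n]

theorem inSkewIdeal_codewordPoly_add_comp_iff {c : Fin n → K} {P : K[X]}
    (hP : IsLinearized Q P) :
    InSkewIdeal Q D (codewordPoly Q c + P.comp (X ^ Q ^ n - X)) ↔ c ∈ D := by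
  refine ⟨fun h => ?_, fun hc => inSkewIdeal_iff.mpr
    ⟨(isLinearized_codewordPoly c).add (hP.comp isLinearized_X_pow_sub_X), c, hc, P, hP, rfl⟩⟩
  obtain ⟨-, c', hc', P', hP', h⟩ := inSkewIdeal_iff.mp h
  rwa [eq_of_codewordPoly_add_comp_eq hP hP' h]

theorem inSkewIdeal_codewordPoly_iff {c : Fin n → K} :
    InSkewIdeal Q D (codewordPoly Q c) ↔ c ∈ D := by
  have h := inSkewIdeal_codewordPoly_add_comp_iff (D := D) (c := c) (IsLinearized.zero (Q := Q))
  rwa [zero_comp, add_zero] at h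

theorem inSkewIdeal_iInf_iff {ι : Type*} [Nonempty ι] {D : ι → Submodule K (Fin n → K)} :
    InSkewIdeal Q (⨅ i, D i) F ↔ ∀ i, InSkewIdeal Q (D i) F := by
  refine ⟨fun h i => h.mono (iInf_le D i), fun h => ?_⟩
  inhabit ι
  obtain ⟨-, c, -, P, hP, rfl⟩ := inSkewIdeal_iff.mp (h default)
  simpa only [inSkewIdeal_codewordPoly_add_comp_iff hP, Submodule.mem_iInf] using h

end Ideal

section PowerCyclic

variable {K : Type*} [Field K] {Q n : ℕ} [NeZero n] {ι : Type*}

/-- `D` is stable under `(c_0, …, c_{n-1}) ↦ (c_{n-1} ^ Q, c_0 ^ Q, …, c_{n-2} ^ Q)`; this is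
`IsSkewCyclic Fq r` for `Q = q ^ r`, and `IsCyclicCode` for `Q = 1`. -/
def IsPowerCyclic (Q : ℕ) (D : Submodule K (Fin n → K)) : Prop :=
  ∀ c ∈ D, shift c ^ Q ∈ D

theorem IsPowerCyclic.iInf {D : ι → Submodule K (Fin n → K)} (h : ∀ i, IsPowerCyclic Q (D i)) :
    IsPowerCyclic Q (⨅ i, D i) := fun c hc => by
  rw [Submodule.mem_iInf] at *
  exact fun i => h i c (hc i)

variable [IsFrobeniusPower K Q]

theorem IsPowerCyclic.iSup {D : ι → Submodule K (Fin n → K)} (h : ∀ i, IsPowerCyclic Q (D i)) :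
    IsPowerCyclic Q (⨆ i, D i) := fun c hc => by
  induction hc using Submodule.iSup_induction' with
  | mem i x hx => exact Submodule.mem_iSup_of_mem i (h i x hx)
  | zero =>
    change (0 : Fin n → K) ^ Q ∈ _
    rw [← powHom_one_apply K, map_zero]
    exact Submodule.zero_mem _
  | add x y _ _ hx hy =>
    change (shift x + shift y) ^ Q ∈ _
    rw [← powHom_one_apply K, map_add, powHom_one_apply, powHom_one_apply]
    exact Submodule.add_mem _ hx hy

variable {D : Submodule K (Fin n → K)} {F P : K[X]}

theorem InSkewIdeal.pow (hD : IsPowerCyclic Q D) (hF : InSkewIdeal Q D F) :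
    InSkewIdeal Q D (F ^ Q) := by
  obtain ⟨-, c, hc, P, hP, rfl⟩ := inSkewIdeal_iff.mp hF
  have hPQ : IsLinearized Q (P ^ Q) := by simpa only [pow_one] using hP.pow 1
  convert (inSkewIdeal_codewordPoly_add_comp_iff
    ((isLinearized_X.C_mul (shift c 0 ^ Q)).add hPQ)).mpr (hD c hc) using 1
  rw [← powHom_one_apply K, map_add, powHom_one_apply, powHom_one_apply, codewordPoly_pow,
    add_comp, mul_comp, C_comp, X_comp, pow_comp, add_assoc]

theorem InSkewIdeal.comp (hD : IsPowerCyclic Q D) (hF : InSkewIdeal Q D F)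
    (hP : IsLinearized Q P) : InSkewIdeal Q D (P.comp F) := by
  induction hP using IsLinearized.induction with
  | add A B _ _ hA hB =>
    rw [add_comp]
    exact hA.add hB
  | C_mul_X_pow a i =>
    have hpow : InSkewIdeal Q D (F ^ Q ^ i) := by
      induction i with
      | zero => rwa [pow_zero, pow_one]
      | succ i ih =>
        rw [pow_succ, pow_mul]
        exact ih.pow hD
    rw [mul_comp, C_comp, X_pow_comp]
    exact hpow.C_mul a

end PowerCyclic

section Generators

variable {K : Type*} [Field K] {Q n : ℕ} {D : Submodule K (Fin n → K)} {F G G' : K[X]}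

/-- `G` is a monic nonzero linearized polynomial of minimal degree among those that represent
codewords of `D` modulo `x ^ (Q ^ n) - x`. -/
structure IsSkewGenerator (Q : ℕ) (D : Submodule K (Fin n → K)) (G : K[X]) : Prop where
  monic : G.Monic
  mem : InSkewIdeal Q D G
  minimal : ∀ F : K[X], InSkewIdeal Q D F → F ≠ 0 → G.natDegree ≤ F.natDegree

theorem IsSkewGenerator.unique (h : IsSkewGenerator Q D G) (h' : IsSkewGenerator Q D G') :
    G = G' := by
  by_contra hne
  have hdeg : G.natDegree = G'.natDegree :=
    le_antisymm (h.minimal _ h'.mem h'.monic.ne_zero) (h'.minimal _ h.mem h.monic.ne_zero)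
  have hsub := sub_ne_zero.mpr hne
  refine (h.minimal _ (h.mem.sub h'.mem) hsub).not_gt ?_
  refine natDegree_lt_natDegree hsub (degree_sub_lt_left ?_ h.monic.ne_zero ?_)
  · rw [degree_eq_natDegree h.monic.ne_zero, degree_eq_natDegree h'.monic.ne_zero, hdeg]
  · rw [h.monic.leadingCoeff, h'.monic.leadingCoeff]

variable [IsFrobeniusPower K Q] [NeZero n]

theorem exists_isSkewGenerator (Q : ℕ) [IsFrobeniusPower K Q] (D : Submodule K (Fin n → K)) :
    ∃ G, IsSkewGenerator Q D G := by
  obtain ⟨F, ⟨hF, hF0⟩, hmin⟩ := exists_minimalFor_of_wellFoundedLT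
    (fun F : K[X] => InSkewIdeal Q D F ∧ F ≠ 0) natDegree
    ⟨_, inSkewIdeal_X_pow_sub_X D, monic_X_pow_sub_X.ne_zero⟩
  refine ⟨C F.leadingCoeff⁻¹ * F, ?_, hF.C_mul _, fun A hA hA0 => ?_⟩
  · rw [mul_comm]
    exact monic_mul_leadingCoeff_inv hF0
  · rw [natDegree_C_mul (inv_ne_zero (leadingCoeff_ne_zero.mpr hF0))]
    exact (le_total F.natDegree A.natDegree).elim id (hmin ⟨hA, hA0⟩)

theorem IsSkewGenerator.inSkewIdeal_iff_rightDvd (h : IsSkewGenerator Q D G)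
    (hD : IsPowerCyclic Q D) : InSkewIdeal Q D F ↔ RightDvd Q G F := by
  refine ⟨fun hF => ?_, ?_⟩
  · obtain ⟨P, R, hP, -, rfl, hdeg⟩ := h.mem.1.exists_comp_add_eq h.monic.ne_zero hF.1
    have hR : InSkewIdeal Q D R := by simpa using hF.sub (h.mem.comp hD hP)
    have hR0 : R = 0 := by
      by_contra hR0
      exact (h.minimal R hR hR0).not_gt (natDegree_lt_natDegree hR0 hdeg)
    exact ⟨P, hP, by rw [hR0, add_zero]⟩
  · rintro ⟨P, hP, rfl⟩
    exact h.mem.comp hD hP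

theorem IsSkewGenerator.exists_comp_eq (h : IsSkewGenerator Q D G) (hD : IsPowerCyclic Q D) :
    ∃ H, IsLinearized Q H ∧ H.comp G = X ^ Q ^ n - X := by
  obtain ⟨H, hH, heq⟩ := (h.inSkewIdeal_iff_rightDvd hD).mp (inSkewIdeal_X_pow_sub_X D)
  exact ⟨H, hH, heq.symm⟩

section Family

variable {ι : Type*} [Nonempty ι] {D : ι → Submodule K (Fin n → K)} {S : ι → K[X]} {A E : K[X]}

theorem InSkewIdeal.rightDvd_of_iSup (hF : InSkewIdeal Q (⨆ i, D i) F)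
    (h : ∀ i F, InSkewIdeal Q (D i) F → RightDvd Q E F) : RightDvd Q E F := by
  obtain ⟨-, c, hc, P, hP, rfl⟩ := inSkewIdeal_iff.mp hF
  clear hF
  refine RightDvd.add ?_ ?_
  · induction hc using Submodule.iSup_induction' with
    | mem i x hx => exact h i _ (inSkewIdeal_codewordPoly_iff.mpr hx)
    | zero => exact ⟨0, .zero, by rw [map_zero, zero_comp]⟩
    | add x y _ _ hx hy =>
      rw [map_add]
      exact hx.add hy
  · inhabit ι
    exact (h default _ (inSkewIdeal_X_pow_sub_X _)).trans ⟨P, hP, rfl⟩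

theorem IsSkewGenerator.isRightLcm (hD : ∀ i, IsPowerCyclic Q (D i))
    (hS : ∀ i, IsSkewGenerator Q (D i) (S i)) (hA : IsSkewGenerator Q (⨅ i, D i) A) :
    IsRightLcm Q S A where
  linearized := hA.mem.1
  monic := hA.monic
  dvd i := ((hS i).inSkewIdeal_iff_rightDvd (hD i)).mp (hA.mem.mono (iInf_le D i))
  least _ _ h := (hA.inSkewIdeal_iff_rightDvd (.iInf hD)).mp <| inSkewIdeal_iInf_iff.mpr
    fun i => ((hS i).inSkewIdeal_iff_rightDvd (hD i)).mpr (h i)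

theorem IsSkewGenerator.isRightGcd (hD : ∀ i, IsPowerCyclic Q (D i))
    (hS : ∀ i, IsSkewGenerator Q (D i) (S i)) (hA : IsSkewGenerator Q (⨆ i, D i) A) :
    IsRightGcd Q S A where
  linearized := hA.mem.1
  monic := hA.monic
  dvd i := (hA.inSkewIdeal_iff_rightDvd (.iSup hD)).mp ((hS i).mem.mono (le_iSup D i))
  greatest _ _ h := hA.mem.rightDvd_of_iSup fun i _ hF =>
    (h i).trans (((hS i).inSkewIdeal_iff_rightDvd (hD i)).mp hF)

end Family

end Generators

section Perp

variable {K : Type*} [Field K] {Q n : ℕ} {F : K[X]}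

theorem isLinearized_linPerp : IsLinearized Q (linPerp Q F) :=
  IsLinearized.sum _ fun _ _ => (isLinearized_X_pow _).C_mul _

theorem isLinearized_linTop : IsLinearized Q (linTop Q n F) :=
  IsLinearized.sum _ fun _ _ => (isLinearized_X_pow _).C_mul _

variable [IsFrobeniusPower K Q]

theorem linCoeff_sum_range (f : ℕ → K) (m k : ℕ) :
    linCoeff Q (∑ i ∈ Finset.range m, C (f i) * X ^ Q ^ i) k = if k < m then f k else 0 := by
  simp [linCoeff_sum, linCoeff_C_mul, linCoeff_X_pow]

theorem linCoeff_linPerp (F : K[X]) (k : ℕ) :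
    linCoeff Q (linPerp Q F) k = if k ≤ linDegree Q F then
      linCoeff Q F (linDegree Q F - k) ^ Q ^ k / linCoeff Q F 0 ^ Q ^ linDegree Q F else 0 := by
  simp only [linPerp, linCoeff_sum_range, Nat.lt_succ_iff]

theorem linCoeff_linTop (n : ℕ) (F : K[X]) (k : ℕ) :
    linCoeff Q (linTop Q n F) k = if k ≤ linDegree Q F then
      (linCoeff Q F (linDegree Q F - k) / linCoeff Q F 0) ^ Q ^ (n - linDegree Q F + k)
      else 0 := by
  simp only [linTop, linCoeff_sum_range, Nat.lt_succ_iff]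

theorem linCoeff_linPerp_linDegree (h0 : linCoeff Q F 0 ≠ 0) :
    linCoeff Q (linPerp Q F) (linDegree Q F) = 1 := by
  rw [linCoeff_linPerp, if_pos le_rfl, Nat.sub_self, div_self (pow_ne_zero _ h0)]

theorem natDegree_linPerp (h0 : linCoeff Q F 0 ≠ 0) :
    (linPerp Q F).natDegree = Q ^ linDegree Q F := by
  refine natDegree_eq_of_le_of_coeff_ne_zero ?_ ?_
  · refine natDegree_le_iff_coeff_eq_zero.mpr fun k hk => ?_
    by_contra hne
    obtain ⟨i, rfl⟩ := isLinearized_linPerp k hne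
    have hi : linDegree Q F < i := (Nat.pow_lt_pow_iff_right (IsFrobeniusPower.one_lt K)).mp hk
    exact hne (by rw [← linCoeff, linCoeff_linPerp, if_neg hi.not_ge])
  · rw [← linCoeff, linCoeff_linPerp_linDegree h0]
    exact one_ne_zero

theorem monic_linPerp (h0 : linCoeff Q F 0 ≠ 0) : (linPerp Q F).Monic := by
  rw [Monic, leadingCoeff, natDegree_linPerp h0]
  exact linCoeff_linPerp_linDegree h0

theorem linTop_linPerp (hK : ∀ a : K, a ^ Q ^ n = a) (hF : IsLinearized Q F) (hm : F.Monic)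
    (hd : linDegree Q F ≤ n) (h0 : linCoeff Q F 0 ≠ 0) : linTop Q n (linPerp Q F) = F := by
  have hzero : linCoeff Q (linPerp Q F) 0 = 1 / linCoeff Q F 0 ^ Q ^ linDegree Q F := by
    rw [linCoeff_linPerp, if_pos (Nat.zero_le _), Nat.sub_zero, pow_zero, pow_one,
      hF.linCoeff_linDegree hm.ne_zero, hm.leadingCoeff]
  refine isLinearized_linTop.ext hF fun k => ?_
  rw [linCoeff_linTop, linDegree_eq_of_natDegree_eq (natDegree_linPerp h0), hzero]
  rcases le_or_gt k (linDegree Q F) with hk | hk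
  · rw [if_pos hk, linCoeff_linPerp, if_pos (Nat.sub_le _ _), Nat.sub_sub_self hk,
      div_div_div_cancel_right₀ (pow_ne_zero _ h0), div_one, ← pow_mul, ← pow_add,
      show linDegree Q F - k + (n - linDegree Q F + k) = n by omega, hK]
  · rw [if_neg hk.not_ge, hF.linCoeff_eq_zero_of_linDegree_lt hk]

theorem linPerp_X_pow_sub_X [NeZero n] :
    linPerp Q (X ^ Q ^ n - X : K[X]) = X ^ Q ^ n - X := by
  have hn : n ≠ 0 := NeZero.ne n
  have hneg (i : ℕ) : (-1 : K) ^ Q ^ i = -1 := by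
    rw [← powHom_apply K, map_neg, map_one]
  refine isLinearized_linPerp.ext isLinearized_X_pow_sub_X fun k => ?_
  rw [linCoeff_linPerp, linDegree_eq_of_natDegree_eq natDegree_X_pow_sub_X]
  simp only [linCoeff_X_pow_sub_X, if_neg hn.symm, if_pos, zero_sub, hneg]
  rcases eq_or_ne k 0 with rfl | hk0
  · simp [hn, hn.symm]
  rcases lt_trichotomy k n with hlt | rfl | hgt
  · simp [hlt.le, hlt.ne, hk0, hlt.not_ge, Nat.sub_eq_zero_iff_le, show n - k ≠ n by omega,
      (IsFrobeniusPower.pos K Q).ne']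
  · simp [hk0, hn.symm, hneg]
  · simp [hgt.not_ge, hgt.ne', hk0]

end Perp

section Dual

theorem shift_injective {K : Type*} {n : ℕ} [NeZero n] :
    Function.Injective (shift : (Fin n → K) → Fin n → K) := fun _ _ h =>
  funext fun i => by simpa [shift] using congrFun h (i + 1)

variable {K : Type*} [Field K] {n : ℕ}

/-- The dual code, with respect to the bilinear form `c ⬝ᵥ y`. -/
def dualCode (D : Submodule K (Fin n → K)) : Submodule K (Fin n → K) :=
  D.dualAnnihilator.comap (dotProductEquiv K (Fin n) : (Fin n → K) →ₗ[K] _)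

theorem mem_dualCode {D : Submodule K (Fin n → K)} {y : Fin n → K} :
    y ∈ dualCode D ↔ ∀ c ∈ D, c ⬝ᵥ y = 0 := by
  simp only [dualCode, Submodule.mem_comap, Submodule.mem_dualAnnihilator, dotProduct_comm _ y]
  rfl

theorem dualCode_iSup {ι : Type*} (D : ι → Submodule K (Fin n → K)) :
    dualCode (⨆ i, D i) = ⨅ i, dualCode (D i) := by
  simp only [dualCode, Submodule.dualAnnihilator_iSup_eq, Submodule.comap_iInf]

theorem dualCode_iInf {ι : Type*} [Finite ι] (D : ι → Submodule K (Fin n → K)) :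
    dualCode (⨅ i, D i) = ⨆ i, dualCode (D i) := by
  simp only [dualCode, Subspace.dualAnnihilator_iInf_eq, Submodule.comap_equiv_eq_map_symm,
    Submodule.map_iSup]

theorem dotProduct_eq_mul_of_lt_of_gt {a b : Fin n → K} {k : Fin n} (ha : ∀ i < k, a i = 0)
    (hb : ∀ i > k, b i = 0) : a ⬝ᵥ b = a k * b k := by
  refine Finset.sum_eq_single_of_mem k (Finset.mem_univ k) fun i _ hi => ?_
  rcases lt_or_gt_of_ne hi with h | h
  · rw [ha i h, zero_mul]
  · rw [hb i h, mul_zero]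

variable [NeZero n]

theorem shift_dotProduct_shift (a b : Fin n → K) : shift a ⬝ᵥ shift b = a ⬝ᵥ b :=
  Fintype.sum_equiv (Equiv.subRight 1) _ _ fun _ => rfl

variable {Q : ℕ} [IsFrobeniusPower K Q]

theorem IsPowerCyclic.dualCode [Finite K] {D : Submodule K (Fin n → K)}
    (hD : IsPowerCyclic Q D) : IsPowerCyclic Q (dualCode D) := by
  intro y hy
  rw [mem_dualCode] at hy ⊢
  intro c hc
  have hinj : Function.Injective fun b : D => (⟨shift b.1 ^ Q, hD b b.2⟩ : D) := fun a b h => by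
    refine Subtype.ext (shift_injective (funext fun i => (powHom K Q K 1).injective ?_))
    simpa only [powHom_one_apply, Pi.pow_apply] using congrFun (congrArg Subtype.val h) i
  obtain ⟨⟨b, hb⟩, hbc⟩ := Finite.surjective_of_injective hinj ⟨c, hc⟩
  obtain rfl : shift b ^ Q = c := congrArg Subtype.val hbc
  calc shift b ^ Q ⬝ᵥ shift y ^ Q = (shift b ⬝ᵥ shift y) ^ Q := by
        simp only [dotProduct, ← powHom_one_apply K, map_sum, map_mul, Pi.pow_apply]
    _ = 0 := by
        rw [shift_dotProduct_shift, hy b hb, ← powHom_one_apply K, map_zero]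

end Dual

section DualGenerator

variable {K : Type*} [Field K] {Q n : ℕ} [IsFrobeniusPower K Q] {P G H : K[X]}

theorem linCoeff_codewordPoly_comp (c : Fin n → K) (hH : IsLinearized Q H)
    (h0 : linCoeff Q H 0 ≠ 0) :
    linCoeff Q ((codewordPoly Q c).comp H) (linDegree Q H) =
      linCoeff Q H 0 ^ Q ^ linDegree Q H * c ⬝ᵥ fun i => linCoeff Q (linPerp Q H) i := by
  rw [codewordPoly_apply, Polynomial.sum_comp, linCoeff_sum, dotProduct, Finset.mul_sum]
  refine Finset.sum_congr rfl fun i _ => ?_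
  rw [mul_comp, C_comp, X_pow_comp, linCoeff_C_mul, hH.linCoeff_pow, linCoeff_linPerp,
    mul_left_comm]
  split_ifs
  · rw [mul_div_cancel₀ _ (pow_ne_zero _ h0)]
  · simp only [mul_zero]

theorem IsLinearized.linCoeff_comp_X_pow_sub_X_of_lt (hP : IsLinearized Q P) {d : ℕ}
    (hd : d < n) : linCoeff Q (P.comp (X ^ Q ^ n - X)) d = -linCoeff Q P d := by
  rw [hP.comp_sub, comp_X, linCoeff_sub, sub_eq_neg_self]
  induction hP using IsLinearized.induction with
  | add A B _ _ hA hB => rw [add_comp, linCoeff_add, hA, hB, add_zero]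
  | C_mul_X_pow a i =>
    rw [mul_comp, C_comp, X_pow_comp, ← pow_mul, ← pow_add, linCoeff_C_mul, linCoeff_X_pow,
      if_neg (by omega), mul_zero]

variable [NeZero n] {D : Submodule K (Fin n → K)}

/-- A codeword polynomial is `P ⊗ G`, so composing it with `H` gives `P ⊗ (x ^ (Q ^ n) - x)`, which
has no term of `Q`-degree `linDegree Q H`. -/
theorem IsSkewGenerator.linCoeff_linPerp_mem_dualCode (hG : IsSkewGenerator Q D G)
    (hD : IsPowerCyclic Q D) (hH : IsLinearized Q H) (h : G.comp H = X ^ Q ^ n - X)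
    (hd : linDegree Q H < n) : (fun i : Fin n => linCoeff Q (linPerp Q H) i) ∈ dualCode D := by
  obtain ⟨-, h0⟩ := linCoeff_zero_ne_zero_of_comp_eq hG.mem.1 hH h
  refine mem_dualCode.mpr fun c hc => ?_
  obtain ⟨P, hP, hPc⟩ :=
    (hG.inSkewIdeal_iff_rightDvd hD).mp (inSkewIdeal_codewordPoly_iff.mpr hc)
  have hPdeg : P.natDegree < Q ^ linDegree Q H := by
    have hlt := natDegree_codewordPoly_lt (Q := Q) c
    rw [hPc, natDegree_comp, hG.mem.1.natDegree_eq hG.monic.ne_zero,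
      ← linDegree_add_linDegree hG.mem.1 hH h, add_comm, pow_add] at hlt
    exact lt_of_mul_lt_mul_right hlt (Nat.zero_le _)
  have hcoeff := linCoeff_codewordPoly_comp c hH h0
  rw [hPc, comp_assoc, h, hP.linCoeff_comp_X_pow_sub_X_of_lt hd, linCoeff,
    coeff_eq_zero_of_natDegree_lt hPdeg, neg_zero] at hcoeff
  exact (mul_eq_zero.mp hcoeff.symm).resolve_left (pow_ne_zero _ h0)

theorem IsSkewGenerator.inSkewIdeal_linPerp (hG : IsSkewGenerator Q D G)
    (hD : IsPowerCyclic Q D) (hH : IsLinearized Q H) (h : G.comp H = X ^ Q ^ n - X) :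
    InSkewIdeal Q (dualCode D) (linPerp Q H) := by
  have hn := linDegree_add_linDegree hG.mem.1 hH h
  rcases (linDegree Q G).eq_zero_or_pos with hg | hg
  · have hGX : G = X := hG.mem.1.eq_X hG.monic (by
      rw [hG.mem.1.natDegree_eq hG.monic.ne_zero, hg, pow_zero])
    rw [hGX, X_comp] at h
    rw [h, linPerp_X_pow_sub_X]
    exact inSkewIdeal_X_pow_sub_X _
  · have hd : linDegree Q H < n := by omega
    rw [← isLinearized_linPerp.codewordPoly_linCoeff (n := n), inSkewIdeal_codewordPoly_iff]
    · exact hG.linCoeff_linPerp_mem_dualCode hD hH h hd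
    · rw [natDegree_linPerp (linCoeff_zero_ne_zero_of_comp_eq hG.mem.1 hH h).2]
      exact Nat.pow_lt_pow_right (IsFrobeniusPower.one_lt K) hd

/-- If `F` had `Q`-degree `k < linDegree Q H`, then `x ^ (Q ^ k) ⊗ G` would be a codeword whose
support meets that of `F` in the coordinate `k` only. -/
theorem IsSkewGenerator.linDegree_le_of_inSkewIdeal_dualCode (hG : IsSkewGenerator Q D G)
    (hD : IsPowerCyclic Q D) (hH : IsLinearized Q H) (h : G.comp H = X ^ Q ^ n - X)
    {F : K[X]} (hF : InSkewIdeal Q (dualCode D) F) (hF0 : F ≠ 0) :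
    linDegree Q H ≤ linDegree Q F := by
  by_contra! hlt
  set k := linDegree Q F with hk
  have hn := linDegree_add_linDegree hG.mem.1 hH h
  have hkn : k < n := by omega
  have hQ := IsFrobeniusPower.one_lt K (Q := Q)
  have hFdeg : F.natDegree < Q ^ n := by
    rw [hF.1.natDegree_eq hF0]
    exact Nat.pow_lt_pow_right hQ hkn
  have hGdeg : (G ^ Q ^ k).natDegree < Q ^ n := by
    rw [natDegree_pow, hG.mem.1.natDegree_eq hG.monic.ne_zero, ← pow_add]
    exact Nat.pow_lt_pow_right hQ (by omega)
  have hGk : InSkewIdeal Q D (G ^ Q ^ k) := by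
    simpa only [X_pow_comp] using hG.mem.comp hD (isLinearized_X_pow k)
  rw [← (hG.mem.1.pow k).codewordPoly_linCoeff hGdeg, inSkewIdeal_codewordPoly_iff] at hGk
  have hF' := hF
  rw [← hF.1.codewordPoly_linCoeff hFdeg, inSkewIdeal_codewordPoly_iff, mem_dualCode] at hF
  have hdot := hF _ hGk
  rw [dotProduct_eq_mul_of_lt_of_gt (k := ⟨k, hkn⟩)] at hdot
  · refine mul_ne_zero ?_ ?_ hdot
    · rw [hG.mem.1.linCoeff_pow, if_pos le_rfl, Nat.sub_self]
      exact pow_ne_zero _ (linCoeff_zero_ne_zero_of_comp_eq hG.mem.1 hH h).1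
    · rw [hF'.1.linCoeff_linDegree hF0]
      exact leadingCoeff_ne_zero.mpr hF0
  · exact fun i hi => by rw [hG.mem.1.linCoeff_pow, if_neg (Fin.lt_def.mp hi).not_ge]
  · exact fun i hi => hF'.1.linCoeff_eq_zero_of_linDegree_lt hi

theorem IsSkewGenerator.dualCode (hG : IsSkewGenerator Q D G) (hD : IsPowerCyclic Q D)
    (hH : IsLinearized Q H) (h : G.comp H = X ^ Q ^ n - X) :
    IsSkewGenerator Q (dualCode D) (linPerp Q H) where
  monic := monic_linPerp (linCoeff_zero_ne_zero_of_comp_eq hG.mem.1 hH h).2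
  mem := hG.inSkewIdeal_linPerp hD hH h
  minimal F hF hF0 := by
    rw [natDegree_linPerp (linCoeff_zero_ne_zero_of_comp_eq hG.mem.1 hH h).2,
      hF.1.natDegree_eq hF0]
    exact Nat.pow_le_pow_right (IsFrobeniusPower.pos K Q)
      (hG.linDegree_le_of_inSkewIdeal_dualCode hD hH h hF hF0)

end DualGenerator

theorem exists_finrank_dvd_add (F E : Type*) [Field F] [Field E] [Algebra F E]
    [FiniteDimensional F E] (s : ℕ) : ∃ t, Module.finrank F E ∣ s + t :=
  ⟨Module.finrank F E * s - s, by
    rw [Nat.add_sub_cancel' (Nat.le_mul_of_pos_left s Module.finrank_pos)]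
    exact dvd_mul_right _ s⟩

section FrobeniusShift

variable {Fq K : Type*} [Fintype Fq] [Field K] {n r : ℕ} {D : Submodule K (Fin n → K)}

theorem frobVec_frobVec (s t : ℕ) (c : Fin n → K) :
    frobVec Fq s (frobVec Fq t c) = frobVec Fq (t + s) c :=
  funext fun i => by simp only [frobVec, ← pow_mul, ← pow_add]

variable [NeZero n] {G H : K[X]}

theorem shift_frobVec (s : ℕ) (c : Fin n → K) :
    shift (frobVec Fq s c) = frobVec Fq s (shift c) := rfl

theorem IsSkewCyclic.isPowerCyclic (h : IsSkewCyclic Fq r D) :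
    IsPowerCyclic (Fintype.card Fq ^ r) D := h

theorem IsPowerCyclic.isSkewCyclic (h : IsPowerCyclic (Fintype.card Fq ^ r) D) :
    IsSkewCyclic Fq r D := h

theorem IsSkewGenCheck.isSkewGenerator (h : IsSkewGenCheck Fq r D G H) :
    IsSkewGenerator (Fintype.card Fq ^ r) D G :=
  ⟨h.monic, h.mem, h.minimal⟩

theorem IsSkewGenCheck.comp_eq_pow_pow (h : IsSkewGenCheck Fq r D G H) :
    G.comp H = X ^ (Fintype.card Fq ^ r) ^ n - X := by
  rw [h.comp_eq, pow_mul]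

end FrobeniusShift

section Frobenius

variable (Fq : Type*) {K : Type*} [Field Fq] [Fintype Fq] [Field K] [Algebra Fq K]

instance isFrobeniusPower_card_pow (r : ℕ) [NeZero r] :
    IsFrobeniusPower K (Fintype.card Fq ^ r) where
  one_lt := Nat.one_lt_pow (NeZero.ne r) Fintype.one_lt_card
  exists_eq_pow := by
    obtain ⟨p, hp⟩ := CharP.exists Fq
    obtain ⟨k, hprime, hk⟩ := FiniteField.card Fq p
    exact ⟨p, k * r, hprime, charP_of_injective_algebraMap (algebraMap Fq K).injective p, by
      rw [hk, pow_mul]⟩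

section MapFrob

variable {n Q : ℕ} {F : K[X]}

theorem frobVec_zero (s : ℕ) : frobVec Fq s (0 : Fin n → K) = 0 :=
  funext fun _ => map_zero (frob Fq s : K →+* K)

theorem frobVec_add (s : ℕ) (a b : Fin n → K) :
    frobVec Fq s (a + b) = frobVec Fq s a + frobVec Fq s b :=
  funext fun i => map_add (frob Fq s) (a i) (b i)

theorem IsLinearized.map_frob (hF : IsLinearized Q F) (s : ℕ) :
    IsLinearized Q (F.map (frob Fq s)) := fun k hk =>
  hF k fun h => hk (by rw [coeff_map, h, map_zero])

theorem map_frob_codewordPoly (s : ℕ) (c : Fin n → K) :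
    (codewordPoly Q c).map (frob Fq s) = codewordPoly Q (frobVec Fq s c) := by
  simp only [codewordPoly_apply, Polynomial.map_sum, Polynomial.map_mul, Polynomial.map_pow,
    map_C, map_X]
  rfl

theorem map_frob_X_pow_sub_X (s k : ℕ) :
    (X ^ k - X : K[X]).map (frob Fq s) = X ^ k - X := by
  rw [Polynomial.map_sub, Polynomial.map_pow, map_X]

end MapFrob

variable [Finite K]

theorem pow_card_pow_of_finrank_dvd {s : ℕ} (h : Module.finrank Fq K ∣ s) (a : K) :
    a ^ Fintype.card Fq ^ s = a := by
  have := Fintype.ofFinite K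
  obtain ⟨t, rfl⟩ := h
  rw [pow_mul, ← Module.card_eq_pow_finrank, FiniteField.pow_card_pow]

variable {n : ℕ}

theorem frobVec_of_finrank_dvd {s : ℕ} (h : Module.finrank Fq K ∣ s) (c : Fin n → K) :
    frobVec Fq s c = c :=
  funext fun i => pow_card_pow_of_finrank_dvd Fq h (c i)

variable {Fq} {r : ℕ} {D : Submodule K (Fin n → K)}

theorem frobVec_mem_frobCode {s : ℕ} {c : Fin n → K} (h : c ∈ D) :
    frobVec Fq s c ∈ frobCode Fq s D :=
  ⟨c, h, rfl⟩

theorem frobCode_frobCode (s t : ℕ) (D : Submodule K (Fin n → K)) :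
    frobCode Fq s (frobCode Fq t D) = frobCode Fq (t + s) D := by
  refine SetLike.coe_injective ?_
  change frobVec Fq s '' (frobVec Fq t '' (D : Set (Fin n → K))) = frobVec Fq (t + s) '' D
  simp only [Set.image_image, frobVec_frobVec]

theorem frobCode_of_finrank_dvd {s : ℕ} (h : Module.finrank Fq K ∣ s)
    (D : Submodule K (Fin n → K)) : frobCode Fq s D = D := by
  refine SetLike.coe_injective ?_
  change frobVec Fq s '' (D : Set (Fin n → K)) = D
  simp only [frobVec_of_finrank_dvd Fq h, Set.image_id']

theorem IsSkewCyclic.frobCode [NeZero n] (h : IsSkewCyclic Fq r D) (s : ℕ) :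
    IsSkewCyclic Fq r (frobCode Fq s D) := by
  rintro _ ⟨c, hc, rfl⟩
  rw [shift_frobVec, frobVec_frobVec, add_comm, ← frobVec_frobVec]
  exact frobVec_mem_frobCode (h c hc)

theorem InSkewIdeal.map_frob {Q : ℕ} {F : K[X]} (hF : InSkewIdeal Q D F) (s : ℕ) :
    InSkewIdeal Q (SkewCyclic.frobCode Fq s D) (F.map (frob Fq s)) := by
  obtain ⟨hl, c, hc, P, hP, rfl⟩ := inSkewIdeal_iff.mp hF
  refine inSkewIdeal_iff.mpr ⟨hl.map_frob Fq s, _, frobVec_mem_frobCode hc, P.map (frob Fq s),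
    hP.map_frob Fq s, ?_⟩
  rw [Polynomial.map_add, map_frob_codewordPoly, Polynomial.map_comp, map_frob_X_pow_sub_X]

end Frobenius

section GaloisStable

variable (Fq : Type*) {K : Type*} [Field Fq] [Fintype Fq] [Field K] [Finite K] [Algebra Fq K]
  {n : ℕ}

/-- The code `D` is stable under all the maps `θ_s`, as the Galois closure and the Galois interior
of any code are. -/
def IsGaloisStable (D : Submodule K (Fin n → K)) : Prop :=
  ∀ s : ℕ, ∀ c ∈ D, frobVec Fq s c ∈ D

variable {Fq} {D : Submodule K (Fin n → K)}

theorem IsGaloisStable.frobCode_eq (h : IsGaloisStable Fq D) (s : ℕ) : frobCode Fq s D = D := by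
  refine le_antisymm ?_ fun c hc => ?_
  · rintro _ ⟨c, hc, rfl⟩
    exact h s c hc
  · obtain ⟨t, ht⟩ := exists_finrank_dvd_add Fq K s
    exact ⟨_, h t c hc, by rw [frobVec_frobVec, add_comm t s, frobVec_of_finrank_dvd Fq ht]⟩

theorem IsGaloisStable.isCyclicCode [NeZero n] {r : ℕ} (h : IsGaloisStable Fq D)
    (hD : IsSkewCyclic Fq r D) : IsCyclicCode D := fun c hc => by
  obtain ⟨t, ht⟩ := exists_finrank_dvd_add Fq K r
  have hmem := h t _ (hD c hc)
  rwa [frobVec_frobVec, frobVec_of_finrank_dvd Fq ht] at hmem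

theorem frobCode_mod_finrank (s : ℕ) (D : Submodule K (Fin n → K)) :
    frobCode Fq (s % Module.finrank Fq K) D = frobCode Fq s D := by
  conv_rhs => rw [← Nat.mod_add_div s (Module.finrank Fq K), ← frobCode_frobCode,
    frobCode_of_finrank_dvd (dvd_mul_right _ _)]

theorem frobCode_le_galoisClosure (s : ℕ) (D : Submodule K (Fin n → K)) :
    frobCode Fq s D ≤ galoisClosure Fq D := by
  rw [← frobCode_mod_finrank]
  exact le_iSup (fun i : Fin (Module.finrank Fq K) => frobCode Fq i D)
    ⟨s % Module.finrank Fq K, Nat.mod_lt _ Module.finrank_pos⟩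

theorem galoisInterior_le_frobCode (s : ℕ) (D : Submodule K (Fin n → K)) :
    galoisInterior Fq D ≤ frobCode Fq s D := by
  rw [← frobCode_mod_finrank]
  exact iInf_le (fun i : Fin (Module.finrank Fq K) => frobCode Fq i D)
    ⟨s % Module.finrank Fq K, Nat.mod_lt _ Module.finrank_pos⟩

theorem isGaloisStable_galoisClosure (D : Submodule K (Fin n → K)) :
    IsGaloisStable Fq (galoisClosure Fq D) := fun s c hc => by
  rw [galoisClosure] at hc
  induction hc using Submodule.iSup_induction' with
  | mem i x hx =>
    refine frobCode_le_galoisClosure (i + s) D ?_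
    rw [← frobCode_frobCode]
    exact frobVec_mem_frobCode hx
  | zero =>
    rw [frobVec_zero]
    exact Submodule.zero_mem _
  | add x y _ _ hx hy =>
    rw [frobVec_add]
    exact Submodule.add_mem _ hx hy

theorem isGaloisStable_galoisInterior (D : Submodule K (Fin n → K)) :
    IsGaloisStable Fq (galoisInterior Fq D) := fun s c hc => by
  refine (Submodule.mem_iInf _).mpr fun i => ?_
  obtain ⟨t, ht⟩ := exists_finrank_dvd_add Fq K s
  have hmem := frobVec_mem_frobCode (Fq := Fq) (s := s) (galoisInterior_le_frobCode (i + t) D hc)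
  rwa [frobCode_frobCode, add_assoc, ← frobCode_frobCode, add_comm t s,
    frobCode_of_finrank_dvd ht] at hmem

end GaloisStable

section SkewCheck

variable {Fq K : Type*} [Field Fq] [Fintype Fq] [Field K] [Algebra Fq K] {n : ℕ} [NeZero n]
  {r : ℕ} [NeZero r] {D : Submodule K (Fin n → K)} {G H G' H' : K[X]}

theorem IsSkewGenCheck.unique (h : IsSkewGenCheck Fq r D G H) (h' : IsSkewGenCheck Fq r D G' H') :
    G = G' ∧ H = H' := by
  obtain rfl := h.isSkewGenerator.unique h'.isSkewGenerator
  exact ⟨rfl, comp_left_injective (h.mem.1.natDegree_ne_zero h.monic.ne_zero)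
    (h.comp_eq'.trans h'.comp_eq'.symm)⟩

theorem IsSkewGenCheck.isSkewGenerator_dualCode (h : IsSkewGenCheck Fq r D G H) :
    IsSkewGenerator (Fintype.card Fq ^ r) (dualCode D) (linPerp (Fintype.card Fq ^ r) H) :=
  h.isSkewGenerator.dualCode h.skewCyclic h.linearized h.comp_eq_pow_pow

end SkewCheck

section Existence

variable {Fq K : Type*} [Field Fq] [Fintype Fq] [Field K] [Finite K] [Algebra Fq K]
  {n : ℕ} [NeZero n] {r : ℕ} {D : Submodule K (Fin n → K)} {G H : K[X]}

theorem IsSkewGenCheck.frobCode (h : IsSkewGenCheck Fq r D G H) (s : ℕ) :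
    IsSkewGenCheck Fq r (frobCode Fq s D) (G.map (frob Fq s)) (H.map (frob Fq s)) where
  skewCyclic := h.skewCyclic.frobCode s
  monic := h.monic.map _
  mem := h.mem.map_frob s
  minimal F hF hF0 := by
    obtain ⟨t, ht⟩ := exists_finrank_dvd_add Fq K s
    have hFt := hF.map_frob (Fq := Fq) t
    rw [frobCode_frobCode, frobCode_of_finrank_dvd ht] at hFt
    rw [natDegree_map, ← natDegree_map (p := F) (frob Fq t)]
    exact h.minimal _ hFt (Polynomial.map_ne_zero hF0)
  linearized := h.linearized.map_frob Fq s
  comp_eq := by rw [← Polynomial.map_comp, h.comp_eq, map_frob_X_pow_sub_X]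
  comp_eq' := by rw [← Polynomial.map_comp, h.comp_eq', map_frob_X_pow_sub_X]

variable [NeZero r]

theorem exists_isSkewGenCheck (hdvd : Module.finrank Fq K ∣ r * n) (hD : IsSkewCyclic Fq r D) :
    ∃ G H, IsSkewGenCheck Fq r D G H := by
  obtain ⟨G, hG⟩ := exists_isSkewGenerator (Fintype.card Fq ^ r) D
  obtain ⟨H, hH, hHG⟩ := hG.exists_comp_eq hD.isPowerCyclic
  have hK (a : K) : a ^ (Fintype.card Fq ^ r) ^ n = a := by
    rw [← pow_mul, pow_card_pow_of_finrank_dvd Fq hdvd]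
  have hGH := comp_eq_X_pow_sub_X_symm hK hH hG.mem.1 hHG
  rw [← pow_mul] at hGH hHG
  exact ⟨G, H, hD, hG.monic, hG.mem, hG.minimal, hH, hGH, hHG⟩

theorem existsUnique_isSkewGenCheck (hdvd : Module.finrank Fq K ∣ r * n)
    (hD : IsSkewCyclic Fq r D) : ∃! P : K[X] × K[X], IsSkewGenCheck Fq r D P.1 P.2 := by
  obtain ⟨G, H, h⟩ := exists_isSkewGenCheck hdvd hD
  exact ⟨(G, H), h, fun P hP => Prod.ext_iff.mpr (hP.unique h)⟩

theorem IsSkewGenCheck.linTop_linPerp (h : IsSkewGenCheck Fq r D G H)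
    (hdvd : Module.finrank Fq K ∣ r * n) :
    linTop (Fintype.card Fq ^ r) n (linPerp (Fintype.card Fq ^ r) H) = H := by
  have hdeg := linDegree_add_linDegree h.mem.1 h.linearized h.comp_eq_pow_pow
  have hmonic : H.Monic := monic_of_monic_comp h.monic
    (h.mem.1.natDegree_ne_zero h.monic.ne_zero) (by
      rw [h.comp_eq', pow_mul]
      exact monic_X_pow_sub_X)
  refine SkewCyclic.linTop_linPerp (fun a => ?_) h.linearized hmonic (by omega)
    (linCoeff_zero_ne_zero_of_comp_eq h.mem.1 h.linearized h.comp_eq_pow_pow).2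
  rw [← pow_mul, pow_card_pow_of_finrank_dvd Fq hdvd]

theorem IsSkewGenCheck.galoisClosure (h : IsSkewGenCheck Fq r D G H)
    (hdvd : Module.finrank Fq K ∣ r * n) :
    IsSkewGenCheck Fq r (galoisClosure Fq D) (upperStar Fq r G) (lowerZero Fq r n H) := by
  have : NeZero (Module.finrank Fq K) := ⟨Module.finrank_pos.ne'⟩
  have hcyc (i : Fin (Module.finrank Fq K)) := (h.skewCyclic.frobCode i).isPowerCyclic
  obtain ⟨A, B, hAB⟩ := exists_isSkewGenCheck hdvd (IsPowerCyclic.iSup hcyc).isSkewCyclic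
  have hA : upperStar Fq r G = A := IsRightGcd.rightGcd_eq <|
    hAB.isSkewGenerator.isRightGcd hcyc fun i => (h.frobCode i).isSkewGenerator
  have hdual := hAB.isSkewGenerator_dualCode
  rw [dualCode_iSup] at hdual
  have hB : lowerZero Fq r n H = B := by
    rw [lowerZero, IsRightLcm.rightLcm_eq (hdual.isRightLcm (fun i => (hcyc i).dualCode)
      fun i => (h.frobCode i).isSkewGenerator_dualCode), hAB.linTop_linPerp hdvd]
  rw [hA, hB]
  exact hAB

theorem IsSkewGenCheck.galoisInterior (h : IsSkewGenCheck Fq r D G H)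
    (hdvd : Module.finrank Fq K ∣ r * n) :
    IsSkewGenCheck Fq r (galoisInterior Fq D) (upperZero Fq r G) (lowerStar Fq r n H) := by
  have : NeZero (Module.finrank Fq K) := ⟨Module.finrank_pos.ne'⟩
  have hcyc (i : Fin (Module.finrank Fq K)) := (h.skewCyclic.frobCode i).isPowerCyclic
  obtain ⟨A, B, hAB⟩ := exists_isSkewGenCheck hdvd (IsPowerCyclic.iInf hcyc).isSkewCyclic
  have hA : upperZero Fq r G = A := IsRightLcm.rightLcm_eq <|
    hAB.isSkewGenerator.isRightLcm hcyc fun i => (h.frobCode i).isSkewGenerator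
  have hdual := hAB.isSkewGenerator_dualCode
  rw [dualCode_iInf] at hdual
  have hB : lowerStar Fq r n H = B := by
    rw [lowerStar, IsRightGcd.rightGcd_eq (hdual.isRightGcd (fun i => (hcyc i).dualCode)
      fun i => (h.frobCode i).isSkewGenerator_dualCode), hAB.linTop_linPerp hdvd]
  rw [hA, hB]
  exact hAB

end Existence

section Conventional

variable {K : Type*} [Field K] {Q : ℕ} [IsFrobeniusPower K Q] {n : ℕ}
  {D : Submodule K (Fin n → K)} {f : K[X]}

theorem linearize_X_pow_sub_one :
    linearize Q (X ^ n - 1 : K[X]) = X ^ Q ^ n - X := by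
  refine (isLinearized_linearize _).ext isLinearized_X_pow_sub_X fun i => ?_
  rw [linCoeff_linearize, linCoeff_X_pow_sub_X, coeff_sub, coeff_X_pow, coeff_one]

theorem coeff_X_pow_sub_one_pow (i : ℕ) :
    (X ^ n - 1 : K[X]).coeff i ^ Q = (X ^ n - 1 : K[X]).coeff i := by
  rw [coeff_sub, coeff_X_pow, coeff_one, ← powHom_one_apply K, map_sub, apply_ite (powHom K Q K 1),
    apply_ite (powHom K Q K 1), map_one, map_zero]

theorem linearize_sum_add_mul_X_pow_sub_one (c : Fin n → K) (p : K[X]) :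
    linearize Q (∑ i : Fin n, C (c i) * X ^ (i : ℕ) + p * (X ^ n - 1)) =
      codewordPoly Q c + (linearize Q p).comp (X ^ Q ^ n - X) := by
  rw [linearize_add, linearize_mul p coeff_X_pow_sub_one_pow, linearize_X_pow_sub_one,
    add_left_inj]
  refine (isLinearized_linearize _).ext (isLinearized_codewordPoly c) fun k => ?_
  rw [linCoeff_linearize, codewordPoly_apply, linCoeff_sum, finsetSum_coeff]
  simp only [linCoeff_C_mul, linCoeff_X_pow, coeff_C_mul, coeff_X_pow]

theorem inSkewIdeal_linearize_iff : InSkewIdeal Q D (linearize Q f) ↔ InIdeal D f := by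
  rw [inSkewIdeal_iff]
  constructor
  · rintro ⟨-, c, hc, P, hP, he⟩
    obtain ⟨p, rfl⟩ := hP.exists_linearize_eq
    rw [← linearize_sum_add_mul_X_pow_sub_one] at he
    exact ⟨c, hc, p, linearize_injective he⟩
  · rintro ⟨c, hc, p, rfl⟩
    exact ⟨isLinearized_linearize _, c, hc, _, isLinearized_linearize p,
      linearize_sum_add_mul_X_pow_sub_one c p⟩

theorem natDegree_linearize_le_iff {f g : K[X]} (hf : f ≠ 0) (hg : g ≠ 0) :
    (linearize Q f).natDegree ≤ (linearize Q g).natDegree ↔ f.natDegree ≤ g.natDegree := by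
  rw [natDegree_linearize hf, natDegree_linearize hg,
    Nat.pow_le_pow_iff_right (IsFrobeniusPower.one_lt K)]

theorem IsSkewGenerator.natDegree_le {g : K[X]} (h : IsSkewGenerator Q D (linearize Q g))
    (hf : InIdeal D f) (hf0 : f ≠ 0) : g.natDegree ≤ f.natDegree :=
  (natDegree_linearize_le_iff (monic_linearize_iff.mp h.monic).ne_zero hf0).mp <|
    h.minimal _ (inSkewIdeal_linearize_iff.mpr hf) (linearize_ne_zero hf0)

theorem IsGenCheck.isSkewGenerator [NeZero n] {g k : K[X]} (h : IsGenCheck D g k) :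
    IsSkewGenerator Q D (linearize Q g) where
  monic := monic_linearize_iff.mpr h.monic
  mem := inSkewIdeal_linearize_iff.mpr h.mem
  minimal F hF hF0 := by
    obtain ⟨f, rfl⟩ := hF.1.exists_linearize_eq
    have hf : f ≠ 0 := by
      rintro rfl
      exact hF0 (sum_zero_index _)
    exact (natDegree_linearize_le_iff h.monic.ne_zero hf).mpr
      (h.minimal f (inSkewIdeal_linearize_iff.mp hF) hf)

end Conventional

section GaloisStableGenerators

variable {Fq K : Type*} [Field Fq] [Fintype Fq] [Field K] [Finite K] [Algebra Fq K]
  {n : ℕ} [NeZero n] {r : ℕ} [NeZero r] {D : Submodule K (Fin n → K)} {G H g k : K[X]}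

theorem IsSkewGenCheck.coeff_pow_eq_of_linearize
    (h : IsSkewGenCheck Fq r D G (linearize (Fintype.card Fq ^ r) k)) (hD : IsGaloisStable Fq D)
    (i : ℕ) : k.coeff i ^ Fintype.card Fq ^ r = k.coeff i := by
  have hfrob := h.frobCode r
  rw [hD.frobCode_eq] at hfrob
  rw [← linCoeff_linearize (Q := Fintype.card Fq ^ r) k i]
  conv_rhs => rw [(h.unique hfrob).2, linCoeff, coeff_map]
  rfl

theorem IsSkewGenCheck.isGenCheck_of_linearize
    (h : IsSkewGenCheck Fq r D (linearize (Fintype.card Fq ^ r) g)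
      (linearize (Fintype.card Fq ^ r) k)) (hD : IsGaloisStable Fq D) : IsGenCheck D g k where
  cyclic := hD.isCyclicCode h.skewCyclic
  monic := monic_linearize_iff.mp h.monic
  mem := inSkewIdeal_linearize_iff.mp h.mem
  minimal _ := h.isSkewGenerator.natDegree_le
  mul_eq := linearize_injective (Q := Fintype.card Fq ^ r) <| by
    rw [linearize_mul g (h.coeff_pow_eq_of_linearize hD), linearize_X_pow_sub_one,
      h.comp_eq_pow_pow]

theorem IsSkewGenCheck.isGenCheck_iff (h : IsSkewGenCheck Fq r D G H)
    (hD : IsGaloisStable Fq D) : IsGenCheck D g k ↔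
      G = linearize (Fintype.card Fq ^ r) g ∧ H = linearize (Fintype.card Fq ^ r) k := by
  refine ⟨fun hgk => ?_, ?_⟩
  · obtain ⟨k', rfl⟩ := h.linearized.exists_linearize_eq
    obtain rfl := h.isSkewGenerator.unique hgk.isSkewGenerator
    have hmul := (h.isGenCheck_of_linearize hD).mul_eq.trans hgk.mul_eq.symm
    exact ⟨rfl, congrArg _ (mul_left_cancel₀ hgk.monic.ne_zero hmul)⟩
  · rintro ⟨rfl, rfl⟩
    exact h.isGenCheck_of_linearize hD

theorem IsSkewGenCheck.existsUnique_isGenCheck (h : IsSkewGenCheck Fq r D G H)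
    (hD : IsGaloisStable Fq D) : ∃! p : K[X] × K[X], IsGenCheck D p.1 p.2 := by
  obtain ⟨g, hg⟩ := h.mem.1.exists_linearize_eq
  obtain ⟨k, hk⟩ := h.linearized.exists_linearize_eq
  refine ⟨(g, k), (h.isGenCheck_iff hD).mpr ⟨hg.symm, hk.symm⟩, fun p hp => ?_⟩
  obtain ⟨hpg, hpk⟩ := (h.isGenCheck_iff hD).mp hp
  exact Prod.ext (linearize_injective (hpg.symm.trans hg.symm))
    (linearize_injective (hpk.symm.trans hk.symm))

end GaloisStableGenerators

end SkewCyclic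

theorem mainTheorem11 (Fq K : Type*) [Field Fq] [Fintype Fq] [Field K] [Finite K] [Algebra Fq K]
    (n r : ℕ) [NeZero n] (hr : 0 < r) (hdvd : Module.finrank Fq K ∣ r * n)
    (C : Submodule K (Fin n → K)) (hC : IsSkewCyclic Fq r C) :
    (∃! P : K[X] × K[X], IsSkewGenCheck Fq r C P.1 P.2) ∧
    (∃! p : K[X] × K[X], IsGenCheck (galoisClosure Fq C) p.1 p.2) ∧
    (∃! p : K[X] × K[X], IsGenCheck (galoisInterior Fq C) p.1 p.2) ∧
    ∀ G H : K[X], IsSkewGenCheck Fq r C G H →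
      IsSkewGenCheck Fq r (galoisClosure Fq C) (upperStar Fq r G) (lowerZero Fq r n H) ∧
      IsSkewGenCheck Fq r (galoisInterior Fq C) (upperZero Fq r G) (lowerStar Fq r n H) ∧
      (∀ gStar hZero : K[X], IsGenCheck (galoisClosure Fq C) gStar hZero →
        upperStar Fq r G = linearize (Fintype.card Fq ^ r) gStar ∧
        lowerZero Fq r n H = linearize (Fintype.card Fq ^ r) hZero) ∧
      (∀ gZero hStar : K[X], IsGenCheck (galoisInterior Fq C) gZero hStar →
        upperZero Fq r G = linearize (Fintype.card Fq ^ r) gZero ∧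
        lowerStar Fq r n H = linearize (Fintype.card Fq ^ r) hStar) := by
  have : NeZero r := ⟨hr.ne'⟩
  have hclosure := isGaloisStable_galoisClosure (Fq := Fq) C
  have hinterior := isGaloisStable_galoisInterior (Fq := Fq) C
  obtain ⟨G₀, H₀, h₀⟩ := exists_isSkewGenCheck hdvd hC
  refine ⟨existsUnique_isSkewGenCheck hdvd hC,
    (h₀.galoisClosure hdvd).existsUnique_isGenCheck hclosure,
    (h₀.galoisInterior hdvd).existsUnique_isGenCheck hinterior, fun G H h => ?_⟩
  have hstar := h.galoisClosure hdvd
  have hzero := h.galoisInterior hdvd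
  exact ⟨hstar, hzero, fun _ _ => (hstar.isGenCheck_iff hclosure).mp,
    fun _ _ => (hzero.isGenCheck_iff hinterior).mp⟩
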